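/- Let $n\ge 0$ and let $A$ be a complex symmetric $n\times n$ matrix with operator norm $\|A\|<1$. Put $$\iota(A)=\begin{bmatrix}\Lambda & A^*\Lambda'\\ A\Lambda & \Lambda'\end{bmatrix},\qquad \Lambda=(I-A^*A)^{-1/2},\quad \Lambda'=(I-AA^*)^{-1/2}.$$ Let $d\mu(z)=\pi^{-n}e^{-|z|^2}d\lambda(z)$ on $\mathbb{C}^n$ ($\lambda$ Lebesgue measure), let $\mathscr F_n$ be the Bargmann-Fock space of entire functions on $\mathbb{C}^n$ that are square integrable for $\mu$, and write $u\cdot v=\sum_i u_iv_i$ (no conjugation). Let $\mathrm{Sp}_c=\mathcal C\,\mathrm{Sp}(2n,\mathbb R)\,\mathcal C^{-1}$ with $\mathcal C=\frac1{\sqrt2}\begin{bmatrix}I&iI\\ I&-iI\end{bmatrix}$. For $S=\begin{bmatrix}\lambda&\mu\\ \bar\mu&\bar\lambda\end{bmatrix}\in\mathrm{Sp}_c$ let $U_S$ be the metaplectic operator $(U_Sf)(z)=\int U_S(z,w)f(w)\,d\mu(w)$ with kernel $$U_S(z,w)=(\det\lambda)^{-1/2}\exp\left\{\tfrac12 z\cdot\bar\mu\lambda^{-1}z-\tfrac12\bar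 w\cdot\lambda^{-1}\mu\bar w+z\cdot(\lambda^{-1})^{T}\bar w\right\}$$ (principal square root). Then $\iota(A)\in\mathrm{Sp}_c$, the integral defining the squeezed state $e_A=U_{\iota(A)}\mathbf 1$ converges absolutely for every $z\in\mathbb C^n$, $e_A\in\mathscr F_n$, and $$e_A(z)=\det(I-A^*A)^{1/4}\,e^{z\cdot Az/2}\qquad(z\in\mathbb C^n).$$ Moreover $I+A$ is invertible; $Z=(I-A)(I+A)^{-1}=X+iY$ with $X,Y$ real symmetric and $X$ positive definite. The Schrödinger form of $e_A$, i.e. the inverse Bargmann transform $$\psi_A(x)=\pi^{-n/4}e^{-x\cdot x/2}\int e^{-\bar z\cdot\bar z/2+\sqrt2\,\bar z\cdot x}\,e_A(z)\,d\mu(z)\qquad(x\in\mathbb R^n),$$ is given by an absolutely convergent integral and equals $$\psi_A(x)=c\left(\frac{\det X}{\pi^n}\right)^{1/4}e^{-x\cdot Zx/2},\qquad c=\frac{\det(I+Z)^{1/2}}{|\det(I+Z)|^{1/2}},\quad |c|=1,$$ where $\det(I+Z)^{1/2}$ is the product of the principal square roots of the eigenvalues of $I+Z$, counted with multiplicity.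 Finally $\psi_A\in L^2(\mathbb R^n)$, $\|\psi_A\|_{L^2}=1$, and the Bargmann transform of $\psi_A$ is $e_A$: for all $z\in\mathbb C^n$, $$\pi^{-n/4}e^{-z\cdot z/2}\int_{\mathbb R^n} e^{-x\cdot x/2+\sqrt2\,z\cdot x}\,\psi_A(x)\,dx=e_A(z),$$ the integral converging absolutely. -/

import Mathlib

open MeasureTheory Matrix

noncomputable section

namespace Squeezed

/-- The bounded domain `𝒟ₙ`: complex symmetric `n × n` matrices whose operator norm on the
Hermitian space `ℂⁿ` is less than one. -/
def domainD (n : ℕ) : Set (Matrix (Fin n) (Fin n) ℂ) :=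
  {A | A.IsSymm ∧ ‖Matrix.toEuclideanCLM (n := Fin n) (𝕜 := ℂ) A‖ < 1}

/-- The Cayley matrix `𝒞 = 2^{-1/2} [[I, iI], [I, -iI]]`; it is unitary, so `𝒞⁻¹ = 𝒞*`. -/
def cayleyMatrix (n : ℕ) : Matrix (Fin n ⊕ Fin n) (Fin n ⊕ Fin n) ℂ :=
  ((1 / Real.sqrt 2 : ℝ) : ℂ) •
    Matrix.fromBlocks 1 (Complex.I • (1 : Matrix (Fin n) (Fin n) ℂ))
      1 (-Complex.I • (1 : Matrix (Fin n) (Fin n) ℂ))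

/-- `Sp_c = 𝒞 Sp(2n, ℝ) 𝒞⁻¹`, the complex realization of the real symplectic group. -/
def SpC (n : ℕ) : Set (Matrix (Fin n ⊕ Fin n) (Fin n ⊕ Fin n) ℂ) :=
  {S | ∃ R ∈ Matrix.symplecticGroup (Fin n) ℝ,
    S = cayleyMatrix n * R.map (fun t : ℝ => (t : ℂ)) * (cayleyMatrix n)ᴴ}

/-- `M^{-1/2}` for a positive definite Hermitian matrix `M`, by the functional calculus. -/
def invSqrt {n : ℕ} (M : Matrix (Fin n) (Fin n) ℂ) : Matrix (Fin n) (Fin n) ℂ :=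
  cfc (fun t : ℝ => t ^ (-(1 / 2) : ℝ)) M

/-- `ι(A) = [[Λ, A* Λ'], [A Λ, Λ']]` with `Λ = (I - A*A)^{-1/2}` and `Λ' = (I - AA*)^{-1/2}`. -/
def iota {n : ℕ} (A : Matrix (Fin n) (Fin n) ℂ) :
    Matrix (Fin n ⊕ Fin n) (Fin n ⊕ Fin n) ℂ :=
  Matrix.fromBlocks (invSqrt (1 - Aᴴ * A)) (Aᴴ * invSqrt (1 - A * Aᴴ))
    (A * invSqrt (1 - Aᴴ * A)) (invSqrt (1 - A * Aᴴ))

/-- The Gaussian measure `dμ(z) = π⁻ⁿ exp(-|z|²) dλ(z)` on `ℂⁿ`, where `|z|² = ∑ |zᵢ|²` and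
`λ` is Lebesgue measure. -/
def gaussMeasure (n : ℕ) : Measure (Fin n → ℂ) :=
  (volume : Measure (Fin n → ℂ)).withDensity
    (fun z => ENNReal.ofReal ((Real.pi ^ n)⁻¹ * Real.exp (-∑ i, ‖z i‖ ^ 2)))

/-- The Bargmann-Fock space `ℱₙ`: entire functions on `ℂⁿ`, square integrable for `dμ`. -/
def fock (n : ℕ) : Set ((Fin n → ℂ) → ℂ) :=
  {f | Differentiable ℂ f ∧ Integrable (fun z => ‖f z‖ ^ 2) (gaussMeasure n)}

/-- The kernel of the metaplectic representation for `S = [[lam, mu], [conj mu, conj lam]]`: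
`(det lam)^{-1/2} exp(½ z·(conj mu)lam⁻¹z - ½ w̄·lam⁻¹mu w̄ + z·(lam⁻¹)ᵀw̄)`. -/
def metaplecticKernel {n : ℕ} (S : Matrix (Fin n ⊕ Fin n) (Fin n ⊕ Fin n) ℂ)
    (z w : Fin n → ℂ) : ℂ :=
  let lam := S.toBlocks₁₁
  let mu := S.toBlocks₁₂
  lam.det ^ (-(1 / 2) : ℂ) *
    Complex.exp (1 / 2 * (z ⬝ᵥ ((mu.map star * lam⁻¹) *ᵥ z))
      - 1 / 2 * (star w ⬝ᵥ ((lam⁻¹ * mu) *ᵥ star w))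
      + z ⬝ᵥ ((lam⁻¹)ᵀ *ᵥ star w))

/-- The operator `U_S`: `(U_S f)(z) = ∫ U_S(z, w) f(w) dμ(w)`. -/
def metaplecticOp {n : ℕ} (S : Matrix (Fin n ⊕ Fin n) (Fin n ⊕ Fin n) ℂ)
    (f : (Fin n → ℂ) → ℂ) (z : Fin n → ℂ) : ℂ :=
  ∫ w, metaplecticKernel S z w * f w ∂(gaussMeasure n)

/-- The squeezed state `e_A = U_{ι(A)} 1`. -/
def squeezedState {n : ℕ} (A : Matrix (Fin n) (Fin n) ℂ) : (Fin n → ℂ) → ℂ :=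
  metaplecticOp (iota A) (fun _ => 1)

/-- The kernel of the Bargmann transform, without the factor `π^{-n/4} exp(-z·z/2)`. -/
def bargmannKernel {n : ℕ} (z : Fin n → ℂ) (x : Fin n → ℝ) : ℂ :=
  Complex.exp (-((x ⬝ᵥ x : ℝ) : ℂ) / 2 + (Real.sqrt 2 : ℂ) * (z ⬝ᵥ fun i => (x i : ℂ)))

/-- The Bargmann transform
`Bψ(z) = π^{-n/4} exp(-z·z/2) ∫ exp(-x·x/2 + √2 z·x) ψ(x) dx`. -/
def bargmann {n : ℕ} (ψ : (Fin n → ℝ) → ℂ) (z : Fin n → ℂ) : ℂ :=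
  ((Real.pi ^ (-(n : ℝ) / 4) : ℝ) : ℂ) * Complex.exp (-(z ⬝ᵥ z) / 2) *
    ∫ x, bargmannKernel z x * ψ x

/-- The kernel of the inverse Bargmann transform, without the factor `π^{-n/4} exp(-x·x/2)`. -/
def invBargmannKernel {n : ℕ} (x : Fin n → ℝ) (z : Fin n → ℂ) : ℂ :=
  Complex.exp (-(star z ⬝ᵥ star z) / 2 + (Real.sqrt 2 : ℂ) * (star z ⬝ᵥ fun i => (x i : ℂ)))

/-- The inverse Bargmann transform
`ψ(x) = π^{-n/4} exp(-x·x/2) ∫ exp(-z̄·z̄/2 + √2 z̄·x) f(z) dμ(z)`. -/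
def invBargmann {n : ℕ} (f : (Fin n → ℂ) → ℂ) (x : Fin n → ℝ) : ℂ :=
  ((Real.pi ^ (-(n : ℝ) / 4) : ℝ) : ℂ) * Complex.exp (-((x ⬝ᵥ x : ℝ) : ℂ) / 2) *
    ∫ z, invBargmannKernel x z * f z ∂(gaussMeasure n)

/-- The squeezed state in the Schrödinger representation. -/
def squeezedSchrodinger {n : ℕ} (A : Matrix (Fin n) (Fin n) ℂ) : (Fin n → ℝ) → ℂ :=
  invBargmann (squeezedState A)

/-- `Z(A) = (I - A)(I + A)⁻¹`. -/
def matZ {n : ℕ} (A : Matrix (Fin n) (Fin n) ℂ) : Matrix (Fin n) (Fin n) ℂ :=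
  (1 - A) * (1 + A)⁻¹

/-- `X`, the entrywise real part of `Z(A)`. -/
def matX {n : ℕ} (A : Matrix (Fin n) (Fin n) ℂ) : Matrix (Fin n) (Fin n) ℝ :=
  (matZ A).map Complex.re

/-- `Y`, the entrywise imaginary part of `Z(A)`. -/
def matY {n : ℕ} (A : Matrix (Fin n) (Fin n) ℂ) : Matrix (Fin n) (Fin n) ℝ :=
  (matZ A).map Complex.im

/-- `det(M)^{1/2}` as the product of the principal square roots of the eigenvalues of `M`, counted
with algebraic multiplicity. On complex symmetric matrices with positive definite real part (all
eigenvalues then have positive real part) this is the continuous branch of the square root of the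
determinant that is positive on real matrices. -/
def detSqrt {n : ℕ} (M : Matrix (Fin n) (Fin n) ℂ) : ℂ :=
  (M.charpoly.roots.map (fun a : ℂ => a ^ (1 / 2 : ℂ))).prod

theorem detSqrt_sq {n : ℕ} (M : Matrix (Fin n) (Fin n) ℂ) : detSqrt M ^ 2 = M.det := by
  rw [detSqrt, ← Multiset.prod_map_pow, Matrix.det_eq_prod_roots_charpoly]
  congr 1
  conv_rhs => rw [← Multiset.map_id M.charpoly.roots]
  refine Multiset.map_congr rfl fun a _ => ?_
  simp

/-- The phase factor `c = det(I + Z)^{1/2} / |det(I + Z)|^{1/2}`. -/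
def phase {n : ℕ} (A : Matrix (Fin n) (Fin n) ℂ) : ℂ :=
  detSqrt (1 + matZ A) / ((Real.sqrt ‖(1 + matZ A).det‖ : ℝ) : ℂ)

end Squeezed

end

/-! Both forms of the state come from two tools: the mean value property of entire functions for the
Gaussian measure, and the Gaussian integral for a complex symmetric matrix with its square root
branch under control.

Bargmann side. The intertwining `A Λ = Λ' A` and `Λᵀ = Λ'` (from the symmetry of `A`) give `ι(A) J
ι(A)ᵀ = J` and reduce the kernel at `ι(A)` to an entire function of `w̄`. Conjugation preserves the
measure, so integrating against `1` returns the value at `w̄ = 0`, namely `det(I - A*A)^{1/4}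
exp(z·Az/2)`.

Gaussian integral (`gaussian_integral`). Simultaneous diagonalization by congruence splits the
integral into one-dimensional ones and fixes it up to sign. The sign follows by continuity along the
segment from `I` to `M`, on which the eigenvalues stay in the right half-plane.

Schrödinger side. The factor `exp(-z̄·z̄/2)` is written as a Gaussian integral over real `t`. After
Fubini, the reproducing property evaluates `exp(z·Az/2)` at `√2 x + it`, and a Gaussian integral
with matrix `I + A` remains. The constants match because `I + Z = 2(I + A)⁻¹` and `(I + A)* X (I +
A) = I - A*A`. The norm and the Bargmann transform are Gaussian integrals with matrices `2X` and `I
+ Z`. -/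

noncomputable section

namespace Squeezed

open scoped ComplexOrder

variable {n : ℕ}

/-! ### Euclidean estimates on the bounded domain -/

/-- The squared Euclidean norm on `ℂⁿ`. -/
def nsq (z : Fin n → ℂ) : ℝ := ∑ i, ‖z i‖ ^ 2

theorem nsq_nonneg (z : Fin n → ℂ) : 0 ≤ nsq z := by unfold nsq; positivity

theorem nsq_pos {z : Fin n → ℂ} (hz : z ≠ 0) : 0 < nsq z := by
  obtain ⟨i, hi⟩ := Function.ne_iff.1 hz
  exact Finset.sum_pos' (fun j _ => by positivity)
    ⟨i, Finset.mem_univ i, by have := norm_pos_iff.2 hi; positivity⟩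

theorem nsq_eq_norm_sq (z : Fin n → ℂ) : nsq z = ‖WithLp.toLp 2 z‖ ^ 2 := by
  rw [EuclideanSpace.norm_sq_eq]; rfl

theorem star_dotProduct_self (z : Fin n → ℂ) : star z ⬝ᵥ z = (nsq z : ℂ) := by
  simp [dotProduct, nsq, Complex.conj_mul']

theorem norm_dotProduct_le (z w : Fin n → ℂ) : ‖z ⬝ᵥ w‖ ≤ √(nsq z) * √(nsq w) := by
  have h := norm_inner_le_norm (𝕜 := ℂ) (WithLp.toLp 2 (star z)) (WithLp.toLp 2 w)
  rw [EuclideanSpace.inner_toLp_toLp, star_star, dotProduct_comm] at h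
  have h1 : nsq (star z) = nsq z := by simp [nsq]
  rwa [← h1, nsq_eq_norm_sq, nsq_eq_norm_sq, Real.sqrt_sq (norm_nonneg _),
    Real.sqrt_sq (norm_nonneg _)]

theorem nsq_mulVec_le (A : Matrix (Fin n) (Fin n) ℂ) (z : Fin n → ℂ) :
    √(nsq (A *ᵥ z)) ≤ ‖Matrix.toEuclideanCLM (n := Fin n) (𝕜 := ℂ) A‖ * √(nsq z) := by
  rw [nsq_eq_norm_sq, nsq_eq_norm_sq, Real.sqrt_sq (norm_nonneg _),
    Real.sqrt_sq (norm_nonneg _)]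
  exact (Matrix.toEuclideanCLM (n := Fin n) (𝕜 := ℂ) A).le_opNorm (WithLp.toLp 2 z)

theorem norm_quad_le (A : Matrix (Fin n) (Fin n) ℂ) (z : Fin n → ℂ) :
    ‖z ⬝ᵥ A *ᵥ z‖ ≤ ‖Matrix.toEuclideanCLM (n := Fin n) (𝕜 := ℂ) A‖ * nsq z := by
  refine (norm_dotProduct_le _ _).trans ?_
  refine (mul_le_mul_of_nonneg_left (nsq_mulVec_le A z) (Real.sqrt_nonneg _)).trans ?_
  nth_rewrite 3 [← Real.sq_sqrt (nsq_nonneg z)]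
  linarith

theorem nsq_mulVec_lt {A : Matrix (Fin n) (Fin n) ℂ} (hA : A ∈ domainD n) {z : Fin n → ℂ}
    (hz : z ≠ 0) : nsq (A *ᵥ z) < nsq z := by
  refine (Real.sqrt_lt_sqrt_iff (nsq_nonneg _)).1 ((nsq_mulVec_le A z).trans_lt ?_)
  have := Real.sqrt_pos.2 (nsq_pos hz)
  nlinarith [hA.2]

theorem posDef_one_sub {A : Matrix (Fin n) (Fin n) ℂ} (hA : A ∈ domainD n) :
    (1 - Aᴴ * A).PosDef := by
  refine Matrix.PosDef.of_dotProduct_mulVec_pos ?_ fun z hz => ?_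
  · simp [Matrix.IsHermitian]
  · rw [sub_mulVec, one_mulVec, dotProduct_sub, ← mulVec_mulVec, dotProduct_mulVec,
      vecMul_conjTranspose, star_star, star_dotProduct_self, star_dotProduct_self,
      ← Complex.ofReal_sub]
    exact_mod_cast sub_pos.2 (nsq_mulVec_lt hA hz)

theorem one_sub_transpose {A : Matrix (Fin n) (Fin n) ℂ} (hA : A.IsSymm) :
    (1 - Aᴴ * A)ᵀ = 1 - A * Aᴴ := by
  rw [transpose_sub, transpose_one, transpose_mul, conjTranspose, ← transpose_map, hA.eq, hA.eq]

theorem posDef_one_sub' {A : Matrix (Fin n) (Fin n) ℂ} (hA : A ∈ domainD n) :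
    (1 - A * Aᴴ).PosDef := by
  rw [← one_sub_transpose hA.1]; exact (posDef_one_sub hA).transpose

theorem isUnit_one_add {A : Matrix (Fin n) (Fin n) ℂ} (hA : A ∈ domainD n) :
    IsUnit (1 + A) := by
  refine Matrix.mulVec_injective_iff_isUnit.1 ?_
  refine (injective_iff_map_eq_zero (Matrix.mulVecLin (1 + A))).2 fun z hz => ?_
  by_contra h
  have h2 : A *ᵥ z = -z := by
    rw [mulVecLin_apply, add_mulVec, one_mulVec] at hz
    exact (neg_eq_of_add_eq_zero_right hz).symm
  have := nsq_mulVec_lt hA h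
  rw [h2] at this
  simp [nsq] at this

/-! ### Functional calculus, the matrix `ι(A)` and its kernel -/

/-- On finitely many Hermitian matrices the functional calculus is given by one polynomial. -/
theorem exists_polynomial_cfc (f : ℝ → ℝ) {M N : Matrix (Fin n) (Fin n) ℂ}
    (hM : M.IsHermitian) (hN : N.IsHermitian) :
    ∃ p : Polynomial ℝ, cfc f M = Polynomial.aeval M p ∧ cfc f N = Polynomial.aeval N p := by
  classical
  have hfin : (spectrum ℝ M ∪ spectrum ℝ N).Finite :=
    (Matrix.finite_real_spectrum (𝕜 := ℂ)).union (Matrix.finite_real_spectrum (𝕜 := ℂ))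
  -- The nodes are the points of both spectra, so a single polynomial serves `M` and `N`;
  -- transposition and intertwining relations then pass through it.
  let p := Lagrange.interpolate hfin.toFinset id f
  have hp : ∀ x ∈ spectrum ℝ M ∪ spectrum ℝ N, f x = p.eval x := fun x hx =>
    (Lagrange.eval_interpolate_at_node (v := id) f Function.injective_id.injOn
      (hfin.mem_toFinset.2 hx)).symm
  refine ⟨p, ?_, ?_⟩
  · rw [← cfc_polynomial p M hM]
    exact cfc_congr fun x hx => hp x (Or.inl hx)
  · rw [← cfc_polynomial p N hN]
    exact cfc_congr fun x hx => hp x (Or.inr hx)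

theorem aeval_transpose (p : Polynomial ℝ) (M : Matrix (Fin n) (Fin n) ℂ) :
    (Polynomial.aeval M p)ᵀ = Polynomial.aeval Mᵀ p := by
  induction p using Polynomial.induction_on' with
  | add p q hp hq => simp [hp, hq]
  | monomial k a =>
    simp only [Polynomial.aeval_monomial, transpose_mul, transpose_pow]
    rw [Algebra.algebraMap_eq_smul_one]
    simp

theorem mul_aeval_comm (p : Polynomial ℝ) {A M N : Matrix (Fin n) (Fin n) ℂ}
    (h : A * M = N * A) : A * Polynomial.aeval M p = Polynomial.aeval N p * A := by
  induction p using Polynomial.induction_on' with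
  | add p q hp hq => simp [hp, hq, mul_add, add_mul]
  | monomial k a =>
    have hk : A * M ^ k = N ^ k * A := by
      induction k with
      | zero => simp
      | succ k ih => rw [pow_succ, pow_succ, ← mul_assoc, ih, mul_assoc, h, mul_assoc]
    simp only [Polynomial.aeval_monomial, Algebra.algebraMap_eq_smul_one, smul_mul_assoc, one_mul,
      mul_smul_comm, hk]

theorem invSqrt_isHermitian (M : Matrix (Fin n) (Fin n) ℂ) : (invSqrt M).IsHermitian :=
  cfc_predicate (fun t : ℝ => t ^ (-(1 / 2) : ℝ)) M

theorem invSqrt_mul_self_mul {M : Matrix (Fin n) (Fin n) ℂ} (hM : M.PosDef) :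
    invSqrt M * invSqrt M * M = 1 := by
  have hpos : ∀ x ∈ spectrum ℝ M, 0 < x := fun x hx => by
    rw [hM.1.spectrum_real_eq_range_eigenvalues] at hx
    obtain ⟨i, rfl⟩ := hx
    exact hM.eigenvalues_pos i
  have hs : IsSelfAdjoint M := hM.1
  -- Every function is continuous on a finite spectrum, so the discontinuity of `t ^ (-1/2)` at `0`
  -- does no harm.
  have hfin := Matrix.finite_real_spectrum (𝕜 := ℂ) (A := M)
  unfold invSqrt
  conv_lhs => rw [← cfc_mul _ _ M (hfin.continuousOn _) (hfin.continuousOn _)]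
  conv_lhs =>
    enter [2]
    rw [← cfc_id' ℝ M]
  rw [← cfc_mul _ _ M (hfin.continuousOn _) (hfin.continuousOn _), ← cfc_one ℝ M]
  refine cfc_congr fun x hx => ?_
  have := hpos x hx
  simp only [Pi.one_apply]
  rw [← Real.rpow_add this]
  norm_num
  rw [Real.rpow_neg_one, inv_mul_cancel₀ this.ne']

theorem det_invSqrt {M : Matrix (Fin n) (Fin n) ℂ} (hM : M.PosDef) :
    ∃ r : ℝ, 0 < r ∧ (invSqrt M).det = (r : ℂ) := by
  have hs := hM.1
  unfold invSqrt
  rw [hs.cfc_eq, Matrix.IsHermitian.cfc, Unitary.conjStarAlgAut_apply, det_mul_comm, ← mul_assoc]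
  simp only [Unitary.coe_star_mul_self, one_mul, det_diagonal, Function.comp_apply]
  have := fun i => Real.rpow_pos_of_pos (hM.eigenvalues_pos i) (-(1/2))
  exact ⟨_, Finset.prod_pos fun i _ => this i, by push_cast; rfl⟩

section Iota

variable {A : Matrix (Fin n) (Fin n) ℂ}

theorem invSqrt_transpose (hA : A ∈ domainD n) :
    (invSqrt (1 - Aᴴ * A))ᵀ = invSqrt (1 - A * Aᴴ) := by
  obtain ⟨p, h1, h2⟩ := exists_polynomial_cfc (fun t : ℝ => t ^ (-(1 / 2) : ℝ))
    (posDef_one_sub hA).1 (posDef_one_sub' hA).1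
  rw [invSqrt, invSqrt, h1, h2, aeval_transpose, one_sub_transpose hA.1]

/-- `A (I - A*A) = (I - AA*) A`, and such a relation passes to polynomials in the two matrices. -/
theorem mul_invSqrt (hA : A ∈ domainD n) :
    A * invSqrt (1 - Aᴴ * A) = invSqrt (1 - A * Aᴴ) * A := by
  obtain ⟨p, h1, h2⟩ := exists_polynomial_cfc (fun t : ℝ => t ^ (-(1 / 2) : ℝ))
    (posDef_one_sub hA).1 (posDef_one_sub' hA).1
  rw [invSqrt, invSqrt, h1, h2]
  exact mul_aeval_comm p (by simp only [mul_sub, sub_mul, mul_one, one_mul, mul_assoc])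

theorem conjTranspose_mul_invSqrt (hA : A ∈ domainD n) :
    Aᴴ * invSqrt (1 - A * Aᴴ) = invSqrt (1 - Aᴴ * A) * Aᴴ := by
  have := congrArg conjTranspose (mul_invSqrt hA)
  rw [conjTranspose_mul, conjTranspose_mul, (invSqrt_isHermitian _).eq,
    (invSqrt_isHermitian _).eq] at this
  exact this.symm

theorem conjTranspose_transpose_of_isSymm (hA : A.IsSymm) : Aᴴᵀ = Aᴴ := by
  rw [conjTranspose, ← transpose_map, hA.eq, hA.eq]

theorem map_star_eq (M : Matrix (Fin n) (Fin n) ℂ) : M.map star = Mᴴᵀ := by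
  rw [conjTranspose, ← transpose_map, transpose_transpose]

theorem invSqrt_map_star (hA : A ∈ domainD n) :
    (invSqrt (1 - Aᴴ * A)).map star = invSqrt (1 - A * Aᴴ) := by
  rw [map_star_eq, (invSqrt_isHermitian _).eq, invSqrt_transpose hA]

theorem iota_map_star (hA : A ∈ domainD n) :
    (Aᴴ * invSqrt (1 - A * Aᴴ)).map star = A * invSqrt (1 - Aᴴ * A) := by
  rw [map_star_eq, conjTranspose_mul, conjTranspose_conjTranspose, (invSqrt_isHermitian _).eq,
    transpose_mul, hA.1.eq, ← invSqrt_transpose hA, transpose_transpose]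

/-- Since `Λᵀ = Λ'`, the diagonal blocks vanish by `A* Λ'² = Λ² A*` and its mirror image, while the
off-diagonal ones reduce to `Λ² (I - A*A) = I` and `Λ'² (I - AA*) = I`. -/
theorem mul_J_mul_transpose_iota (hA : A ∈ domainD n) :
    iota A * J (Fin n) ℂ * (iota A)ᵀ = J (Fin n) ℂ := by
  have h1 := invSqrt_transpose hA
  have h1' : (invSqrt (1 - A * Aᴴ))ᵀ = invSqrt (1 - Aᴴ * A) := by rw [← h1, transpose_transpose]
  have h2 := mul_invSqrt hA
  have h3 := conjTranspose_mul_invSqrt hA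
  have h4 := invSqrt_mul_self_mul (posDef_one_sub hA)
  have h5 := invSqrt_mul_self_mul (posDef_one_sub' hA)
  have hs := hA.1.eq
  have hs' := conjTranspose_transpose_of_isSymm hA.1
  rw [iota, J, fromBlocks_multiply, fromBlocks_transpose, fromBlocks_multiply]
  simp only [transpose_mul, h1, h1', hs, hs']
  generalize invSqrt (1 - Aᴴ * A) = L at *
  generalize invSqrt (1 - A * Aᴴ) = K at *
  have e1 : L * L - L * L * Aᴴ * A = 1 := by rw [← h4]; noncomm_ring
  have e2 : K * K - K * K * A * Aᴴ = 1 := by rw [← h5]; noncomm_ring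
  have g1 : Aᴴ * K * K = L * L * Aᴴ := by rw [h3, mul_assoc, h3, mul_assoc]
  have g2 : A * L * L = K * K * A := by rw [h2, mul_assoc, h2, mul_assoc]
  have e3 : Aᴴ * K * (K * A) = L * L * Aᴴ * A := by rw [← mul_assoc, g1]
  have e4 : A * L * (L * Aᴴ) = K * K * A * Aᴴ := by rw [← mul_assoc, g2]
  congr 1
  · simp [g1, mul_assoc]
  · simp [e3]
    rw [← e1]
    abel
  · simp [e4]
    rw [← e2]
    abel
  · simp [g2, mul_assoc]

theorem cayley_mul_conjTranspose : cayleyMatrix n * (cayleyMatrix n)ᴴ = 1 := by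
  rw [cayleyMatrix, conjTranspose_smul, fromBlocks_conjTranspose, smul_mul_smul_comm,
    fromBlocks_multiply, ← fromBlocks_one, fromBlocks_smul]
  have h : ((1 / √2 : ℝ) : ℂ) * star ((1 / √2 : ℝ) : ℂ) = 1 / 2 := by
    rw [Complex.star_def, Complex.conj_ofReal, ← Complex.ofReal_mul]
    rw [div_mul_div_comm, Real.mul_self_sqrt (by norm_num)]; norm_num
  rw [h]
  congr 1 <;> (simp [smul_smul, ← two_smul ℂ (1 : Matrix (Fin n) (Fin n) ℂ)])

/-- The scalars `i` and `-i` have product `1`, so conjugation by the Cayley matrix preserves the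
symplectic relation. -/
theorem cayley_conj_J :
    (cayleyMatrix n)ᴴ * J (Fin n) ℂ * ((cayleyMatrix n)ᴴ)ᵀ = Complex.I • J (Fin n) ℂ ∧
    cayleyMatrix n * J (Fin n) ℂ * (cayleyMatrix n)ᵀ = -Complex.I • J (Fin n) ℂ := by
  have h : ((1 / √2 : ℝ) : ℂ) * ((1 / √2 : ℝ) : ℂ) = 1 / 2 := by
    rw [← Complex.ofReal_mul]
    rw [div_mul_div_comm, Real.mul_self_sqrt (by norm_num)]; norm_num
  constructor
  · rw [cayleyMatrix, conjTranspose_smul, fromBlocks_conjTranspose, transpose_smul,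
      fromBlocks_transpose, smul_mul_assoc, smul_mul_smul_comm, J, fromBlocks_multiply,
      fromBlocks_multiply, fromBlocks_smul, fromBlocks_smul, Complex.star_def,
      Complex.conj_ofReal, h]
    congr 1 <;> (simp [smul_smul]; try module)
  · rw [cayleyMatrix, transpose_smul,
      fromBlocks_transpose, smul_mul_assoc, smul_mul_smul_comm, J, fromBlocks_multiply,
      fromBlocks_multiply, fromBlocks_smul, fromBlocks_smul, h]
    congr 1 <;> (simp [smul_smul]; try module)

/-- Swapping the block rows of `𝒞` conjugates it, and by hypothesis swapping the block rows and
columns of `S` conjugates it; hence `𝒞* S 𝒞` equals its own conjugate. -/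
theorem cayley_conj_real {S : Matrix (Fin n ⊕ Fin n) (Fin n ⊕ Fin n) ℂ}
    (h1 : S.toBlocks₂₂ = S.toBlocks₁₁.map star) (h2 : S.toBlocks₂₁ = S.toBlocks₁₂.map star) :
    (((cayleyMatrix n)ᴴ * S * cayleyMatrix n).map Complex.re).map (fun t : ℝ => (t : ℂ)) =
      (cayleyMatrix n)ᴴ * S * cayleyMatrix n := by
  have h : ((1 / √2 : ℝ) : ℂ) * ((1 / √2 : ℝ) : ℂ) = 1 / 2 := by
    rw [← Complex.ofReal_mul]
    rw [div_mul_div_comm, Real.mul_self_sqrt (by norm_num)]; norm_num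
  rw [← fromBlocks_toBlocks S, h1, h2]
  rw [cayleyMatrix, conjTranspose_smul, fromBlocks_conjTranspose, smul_mul_assoc,
    smul_mul_smul_comm, fromBlocks_multiply, fromBlocks_multiply, fromBlocks_smul,
    Complex.star_def, Complex.conj_ofReal, h, fromBlocks_map, fromBlocks_map]
  congr 1 <;> (ext i j; apply Complex.ext <;> simp <;> ring)

theorem iota_mem_SpC (hA : A ∈ domainD n) : iota A ∈ SpC n := by
  have hC := cayley_mul_conjTranspose (n := n)
  have hR := cayley_conj_real (S := iota A) (by rw [iota, toBlocks_fromBlocks₂₂,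
    toBlocks_fromBlocks₁₁, invSqrt_map_star hA])
    (by rw [iota, toBlocks_fromBlocks₂₁, toBlocks_fromBlocks₁₂, iota_map_star hA])
  refine ⟨((cayleyMatrix n)ᴴ * iota A * cayleyMatrix n).map Complex.re, ?_, ?_⟩
  · rw [SymplecticGroup.mem_iff]
    apply Matrix.map_injective Complex.ofReal_injective
    have key : ((cayleyMatrix n)ᴴ * iota A * cayleyMatrix n) * J (Fin n) ℂ *
        ((cayleyMatrix n)ᴴ * iota A * cayleyMatrix n)ᵀ = J (Fin n) ℂ := by
      calc _ = (cayleyMatrix n)ᴴ * (iota A *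
            (cayleyMatrix n * J (Fin n) ℂ * (cayleyMatrix n)ᵀ) * (iota A)ᵀ) *
              ((cayleyMatrix n)ᴴ)ᵀ := by
            simp only [transpose_mul, mul_assoc]
        _ = _ := by
            rw [cayley_conj_J.2, mul_smul_comm, smul_mul_assoc, mul_J_mul_transpose_iota hA,
              mul_smul_comm, smul_mul_assoc, cayley_conj_J.1, smul_smul]
            simp
    rw [← hR] at key
    have hJ := Matrix.map_J (Fin n) Complex.ofRealHom
    change ((_ * J (Fin n) ℝ * _ : Matrix _ _ ℝ).map Complex.ofRealHom) =
      (J (Fin n) ℝ).map Complex.ofRealHom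
    rw [Matrix.map_mul, Matrix.map_mul, transpose_map, hJ]
    exact key
  · rw [hR]
    calc iota A = (cayleyMatrix n * (cayleyMatrix n)ᴴ) * iota A *
        (cayleyMatrix n * (cayleyMatrix n)ᴴ) := by rw [hC, one_mul, mul_one]
      _ = _ := by simp only [mul_assoc]

/-- Both determinants are positive reals, `r` and `r⁻²`, so the principal powers are real powers and
no branch question arises. -/
theorem det_invSqrt_cpow {M : Matrix (Fin n) (Fin n) ℂ} (hM : M.PosDef) :
    (invSqrt M).det ^ (-(1 / 2) : ℂ) = M.det ^ (1 / 4 : ℂ) := by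
  obtain ⟨r, hr, h⟩ := det_invSqrt hM
  have h1 := congrArg det (invSqrt_mul_self_mul hM)
  rw [det_mul, det_mul, det_one, h] at h1
  have hr' : (r : ℂ) ≠ 0 := by exact_mod_cast hr.ne'
  have h2 : M.det = ((r ^ (-2 : ℝ) : ℝ) : ℂ) := by
    rw [Real.rpow_neg hr.le]
    norm_num
    field_simp
    linear_combination h1
  rw [h, h2, show (-(1 / 2) : ℂ) = ((-(1 / 2) : ℝ) : ℂ) by push_cast; rfl,
    show (1 / 4 : ℂ) = ((1 / 4 : ℝ) : ℂ) by push_cast; rfl, ← Complex.ofReal_cpow hr.le,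
    ← Complex.ofReal_cpow (by positivity), ← Real.rpow_mul hr.le]
  norm_num

/-- Here `μ = A* Λ' = Λ A*` and `μ̄ = A Λ`, so `μ̄ λ⁻¹ = A` and `λ⁻¹ μ = A*`. -/
theorem metaplecticKernel_iota (hA : A ∈ domainD n) (z w : Fin n → ℂ) :
    metaplecticKernel (iota A) z w = (1 - Aᴴ * A).det ^ (1 / 4 : ℂ) *
      Complex.exp (1 / 2 * (z ⬝ᵥ A *ᵥ z) - 1 / 2 * (star w ⬝ᵥ Aᴴ *ᵥ star w) +
        z ⬝ᵥ ((invSqrt (1 - Aᴴ * A))⁻¹ᵀ *ᵥ star w)) := by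
  have hu : IsUnit (invSqrt (1 - Aᴴ * A)).det := by
    obtain ⟨r, hr, h⟩ := det_invSqrt (posDef_one_sub hA)
    rw [h]
    exact (Complex.ofReal_ne_zero.2 hr.ne').isUnit
  simp only [metaplecticKernel, iota, toBlocks_fromBlocks₁₁, toBlocks_fromBlocks₁₂]
  rw [iota_map_star hA, conjTranspose_mul_invSqrt hA, det_invSqrt_cpow (posDef_one_sub hA),
    mul_nonsing_inv_cancel_right _ _ hu, nonsing_inv_mul_cancel_left _ _ hu]

end Iota

/-! ### Accretive matrices and the square root of the determinant -/

/-- A complex matrix whose Hermitian part is positive definite. -/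
def IsAccretive (M : Matrix (Fin n) (Fin n) ℂ) : Prop :=
  ∀ v : Fin n → ℂ, v ≠ 0 → 0 < (star v ⬝ᵥ M *ᵥ v).re

/-- This expresses the determinant along the segment from `I` to `M` through the fixed multiset of
eigenvalues of `M`. For `v ≠ 0` it is the characteristic polynomial at `-u/v`, rescaled by `(-v)^n`.
-/
theorem det_smul_one_add_smul (M : Matrix (Fin n) (Fin n) ℂ) (u v : ℂ) :
    (u • (1 : Matrix (Fin n) (Fin n) ℂ) + v • M).det =
      (M.charpoly.roots.map fun a => u + v * a).prod := by
  have hcard : M.charpoly.roots.card = n := by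
    rw [IsAlgClosed.card_roots_eq_natDegree, charpoly_natDegree_eq_dim, Fintype.card_fin]
  by_cases hv : v = 0
  · simp [hv, hcard]
  have h1 : u • (1 : Matrix (Fin n) (Fin n) ℂ) + v • M = (-v) • (scalar (Fin n) (-u / v) - M) := by
    rw [smul_sub, scalar_apply, ← smul_one_eq_diagonal, smul_smul]
    rw [show -v * (-u / v) = u by field_simp]
    module
  have h2 : M.charpoly.eval (-u / v) = (M.charpoly.roots.map fun a => -u / v - a).prod := by
    conv_lhs => rw [(IsAlgClosed.splits M.charpoly).eq_prod_roots_of_monic M.charpoly_monic]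
    rw [Polynomial.eval_multiset_prod, Multiset.map_map]
    simp
  have h3 : (-v) ^ n = (-v) ^ M.charpoly.roots.card := by rw [hcard]
  rw [h1, det_smul, ← eval_charpoly, h2, Fintype.card_fin, h3]
  rw [← Multiset.prod_replicate, ← Multiset.map_const', ← Multiset.prod_map_mul]
  congr 1
  refine Multiset.map_congr rfl fun a _ => ?_
  field_simp
  ring

/-- For an eigenvector `v` of `a`, the real part of `v* M v` is `Re a · |v|²`. -/
theorem IsAccretive.re_pos_of_mem_roots {M : Matrix (Fin n) (Fin n) ℂ} (hM : IsAccretive M)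
    {a : ℂ} (ha : a ∈ M.charpoly.roots) : 0 < a.re := by
  have h := (Polynomial.mem_roots'.1 ha).2
  rw [Polynomial.IsRoot, eval_charpoly] at h
  obtain ⟨v, hv, h⟩ := exists_mulVec_eq_zero_iff.2 h
  rw [sub_mulVec, sub_eq_zero, scalar_apply, ← smul_one_eq_diagonal, smul_mulVec, one_mulVec] at h
  have h2 := hM v hv
  rw [← h, dotProduct_smul, star_dotProduct_self, smul_eq_mul, Complex.re_mul_ofReal] at h2
  exact pos_of_mul_pos_left h2 (nsq_nonneg v)

theorem IsAccretive.det_ne_zero {M : Matrix (Fin n) (Fin n) ℂ} (hM : IsAccretive M) :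
    M.det ≠ 0 := by
  rw [det_eq_prod_roots_charpoly]
  refine Multiset.prod_ne_zero fun h => ?_
  simpa using hM.re_pos_of_mem_roots h

theorem detSqrt_ne_zero {M : Matrix (Fin n) (Fin n) ℂ} (hM : IsAccretive M) :
    detSqrt M ≠ 0 := fun h => hM.det_ne_zero (by rw [← detSqrt_sq, h]; simp)

/-- The characteristic polynomials agree at each `x` after multiplication by `det M ≠ 0`, because
`(x - 2M⁻¹) M = xM - 2`. -/
theorem charpoly_roots_two_smul_inv {M : Matrix (Fin n) (Fin n) ℂ} (hM : IsAccretive M) :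
    ((2 : ℂ) • M⁻¹).charpoly.roots = M.charpoly.roots.map fun a => 2 / a := by
  rw [← Polynomial.roots_multiset_prod_X_sub_C (M.charpoly.roots.map fun a => 2 / a)]
  congr 1
  refine Polynomial.funext fun x => ?_
  have hu : IsUnit M.det := hM.det_ne_zero.isUnit
  rw [eval_charpoly, Polynomial.eval_multiset_prod, Multiset.map_map, Multiset.map_map]
  have h1 : (scalar (Fin n) x - (2 : ℂ) • M⁻¹) * M =
      (-2 : ℂ) • (1 : Matrix (Fin n) (Fin n) ℂ) + x • M := by
    rw [sub_mul, smul_mul_assoc, nonsing_inv_mul _ hu, scalar_apply, ← smul_one_eq_diagonal,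
      smul_mul_assoc, one_mul]
    module
  have h2 := congrArg det h1
  rw [det_mul, det_smul_one_add_smul] at h2
  refine mul_right_cancel₀ hM.det_ne_zero (h2.trans ?_)
  rw [det_eq_prod_roots_charpoly]
  conv_rhs => enter [2]; rw [← Multiset.map_id M.charpoly.roots]
  rw [← Multiset.prod_map_mul]
  congr 1
  refine Multiset.map_congr rfl fun a ha => ?_
  have : a ≠ 0 := fun h => by simpa [h] using hM.re_pos_of_mem_roots ha
  simp
  field_simp
  ring

/-- Eigenvalues have positive real part, so `log (a⁻¹) = -log a` and the principal roots satisfy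
`(2/a)^{1/2} a^{1/2} = √2`. -/
theorem detSqrt_two_smul_inv {M : Matrix (Fin n) (Fin n) ℂ} (hM : IsAccretive M) :
    detSqrt ((2 : ℂ) • M⁻¹) * detSqrt M = ((√2 ^ n : ℝ) : ℂ) := by
  have hcard : M.charpoly.roots.card = n := by
    rw [IsAlgClosed.card_roots_eq_natDegree, charpoly_natDegree_eq_dim, Fintype.card_fin]
  rw [detSqrt, detSqrt, charpoly_roots_two_smul_inv hM, Multiset.map_map, ← Multiset.prod_map_mul]
  have : ∀ a ∈ M.charpoly.roots,
      ((fun a : ℂ => a ^ (1 / 2 : ℂ)) ∘ fun a => 2 / a) a * a ^ (1 / 2 : ℂ) = ((√2 : ℝ) : ℂ) := by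
    intro a ha
    have hre := hM.re_pos_of_mem_roots ha
    have h0 : a ≠ 0 := fun h => by simp [h] at hre
    have harg : a.arg ≠ Real.pi := fun h => by
      rw [Complex.arg_eq_pi_iff] at h; linarith [h.1]
    have h2 : (2 : ℂ) / a = ((2 : ℝ) : ℂ) * a⁻¹ := by push_cast; rfl
    simp only [Function.comp_apply]
    rw [h2, Complex.cpow_def_of_ne_zero (mul_ne_zero (by norm_num) (inv_ne_zero h0)),
      Complex.cpow_def_of_ne_zero h0, Complex.log_ofReal_mul (by norm_num) (inv_ne_zero h0),
      Complex.log_inv _ harg, ← Complex.exp_add, Real.sqrt_eq_rpow,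
      Real.rpow_def_of_pos (by norm_num), Complex.ofReal_exp]
    congr 1
    push_cast
    ring
  rw [Multiset.map_congr rfl this, Multiset.map_const', Multiset.prod_replicate, hcard]
  push_cast; rfl

/-! ### Real and imaginary parts of symmetric matrices -/

/-- The inclusion `ℝⁿ → ℂⁿ`. -/
def cvec (x : Fin n → ℝ) : Fin n → ℂ := fun i => (x i : ℂ)

theorem cvec_mulVec (B : Matrix (Fin n) (Fin n) ℝ) (x : Fin n → ℝ) :
    B.map Complex.ofReal *ᵥ cvec x = cvec (B *ᵥ x) := by
  ext i; simp [cvec, mulVec, dotProduct]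

theorem cvec_dotProduct (x y : Fin n → ℝ) : cvec x ⬝ᵥ cvec y = ((x ⬝ᵥ y : ℝ) : ℂ) := by
  simp [cvec, dotProduct]

theorem star_cvec (x : Fin n → ℝ) : star (cvec x) = cvec x := by
  ext i; simp [cvec]

theorem continuous_cvec : Continuous (cvec (n := n)) := by unfold cvec; fun_prop

theorem cvec_ne_zero {x : Fin n → ℝ} (hx : x ≠ 0) : cvec x ≠ 0 := fun h => hx <| by
  ext i; simpa [cvec] using congrFun h i

theorem map_re_add_map_im (M : Matrix (Fin n) (Fin n) ℂ) :
    M = (M.map Complex.re).map Complex.ofReal +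
      Complex.I • (M.map Complex.im).map Complex.ofReal := by
  ext i j
  apply Complex.ext <;> simp

theorem re_quad_cvec (M : Matrix (Fin n) (Fin n) ℂ) (x : Fin n → ℝ) :
    (cvec x ⬝ᵥ M *ᵥ cvec x).re = x ⬝ᵥ M.map Complex.re *ᵥ x := by
  conv_lhs => rw [map_re_add_map_im M]
  rw [add_mulVec, smul_mulVec, cvec_mulVec, cvec_mulVec, dotProduct_add, dotProduct_smul,
    cvec_dotProduct, cvec_dotProduct]
  simp

theorem IsAccretive.posDef_re {M : Matrix (Fin n) (Fin n) ℂ} (hM : IsAccretive M)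
    (hs : M.IsSymm) : (M.map Complex.re).PosDef := by
  refine Matrix.PosDef.of_dotProduct_mulVec_pos ?_ fun x hx => ?_
  · rw [Matrix.IsHermitian, conjTranspose_eq_transpose_of_trivial, ← transpose_map, hs.eq]
  · have := hM _ (cvec_ne_zero hx)
    rwa [star_cvec, re_quad_cvec] at this

theorem exists_orthogonal_diagonal {H : Matrix (Fin n) (Fin n) ℝ} (hH : H.IsHermitian) :
    ∃ (U : Matrix (Fin n) (Fin n) ℝ) (d : Fin n → ℝ), U * Uᵀ = 1 ∧ H = U * diagonal d * Uᵀ := by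
  refine ⟨hH.eigenvectorUnitary, hH.eigenvalues, ?_, ?_⟩
  · rw [← conjTranspose_eq_transpose_of_trivial]
    exact Unitary.coe_mul_star_self hH.eigenvectorUnitary
  · rw [← conjTranspose_eq_transpose_of_trivial]
    exact hH.spectral_theorem.trans (Unitary.conjStarAlgAut_apply _ _)

open scoped MatrixOrder in
/-- Simultaneous diagonalization by congruence of the real and imaginary part. -/
theorem exists_congr_diagonal {M : Matrix (Fin n) (Fin n) ℂ} (hM : IsAccretive M)
    (hs : M.IsSymm) : ∃ (B : Matrix (Fin n) (Fin n) ℝ) (d : Fin n → ℝ), B.det ≠ 0 ∧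
      M = (B.map Complex.ofReal)ᵀ * diagonal (fun i => 1 + Complex.I * d i) *
        B.map Complex.ofReal := by
  have hX := hM.posDef_re hs
  obtain ⟨C, hC⟩ := CStarAlgebra.nonneg_iff_eq_star_mul_self.1 hX.posSemidef.nonneg
  have hC' : M.map Complex.re = Cᵀ * C := by
    rw [hC, star_eq_conjTranspose, conjTranspose_eq_transpose_of_trivial]
  have hdet : IsUnit C.det := by
    have h := hX.det_pos
    rw [hC', det_mul, det_transpose] at h
    exact (by rintro h0; simp [h0] at h : C.det ≠ 0).isUnit
  have hdet' : IsUnit Cᵀ.det := by rwa [det_transpose]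
  have hY : (M.map Complex.im)ᵀ = M.map Complex.im := by rw [← transpose_map, hs.eq]
  have hH : ((Cᵀ)⁻¹ * M.map Complex.im * C⁻¹).IsHermitian := by
    rw [Matrix.IsHermitian, conjTranspose_eq_transpose_of_trivial, transpose_mul, transpose_mul,
      hY, transpose_nonsing_inv, transpose_nonsing_inv, transpose_transpose, mul_assoc]
  -- With `X = CᵀC`, the congruence by `C⁻¹` sends `X` to `I`; an orthogonal diagonalization of the
  -- transformed `Y` keeps `I` fixed, so `B = UᵀC` works for both parts.
  obtain ⟨U, d, hU, hsp⟩ := exists_orthogonal_diagonal hH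
  have hYd : M.map Complex.im = (Uᵀ * C)ᵀ * diagonal d * (Uᵀ * C) := by
    calc M.map Complex.im = Cᵀ * ((Cᵀ)⁻¹ * M.map Complex.im * C⁻¹) * C := by
          rw [← mul_assoc, nonsing_inv_mul_cancel_right _ _ hdet,
            mul_nonsing_inv_cancel_left _ _ hdet']
      _ = _ := by rw [hsp, transpose_mul, transpose_transpose]; simp only [mul_assoc]
  have hXd : M.map Complex.re = (Uᵀ * C)ᵀ * (Uᵀ * C) := by
    rw [hC', transpose_mul, transpose_transpose, mul_assoc, ← mul_assoc U, hU, one_mul]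
  refine ⟨Uᵀ * C, d, ?_, ?_⟩
  · have h := hX.det_pos
    rw [hXd, det_mul, det_transpose] at h
    rintro h0; simp [h0] at h
  · conv_lhs => rw [map_re_add_map_im M, hXd, hYd]
    generalize Uᵀ * C = B
    have h1 : (diagonal fun i => 1 + Complex.I * (d i : ℂ)) =
        (1 : Matrix (Fin n) (Fin n) ℂ) +
          Complex.I • (diagonal d).map Complex.ofReal := by
      ext i j
      by_cases hij : i = j <;> simp [hij, diagonal, one_apply]
    rw [h1, mul_add, add_mul, mul_one, mul_smul_comm, smul_mul_assoc]
    have hm : ∀ P Q : Matrix (Fin n) (Fin n) ℝ, (P * Q).map Complex.ofReal =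
      P.map Complex.ofReal * Q.map Complex.ofReal := fun P Q =>
        Matrix.map_mul (f := Complex.ofRealHom)
    rw [hm, hm, hm, transpose_map]

/-! ### Gaussian integrals with complex symmetric matrices -/

/-- The Gaussian `x ↦ exp(-½ x·Mx + b·x)` on `ℝⁿ`. -/
def gaussFun (M : Matrix (Fin n) (Fin n) ℂ) (b : Fin n → ℂ) (x : Fin n → ℝ) : ℂ :=
  Complex.exp (-(1 / 2) * (cvec x ⬝ᵥ M *ᵥ cvec x) + b ⬝ᵥ cvec x)

theorem continuous_gaussFun (M : Matrix (Fin n) (Fin n) ℂ) (b : Fin n → ℂ) :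
    Continuous (gaussFun M b) := by
  have := continuous_cvec (n := n)
  unfold gaussFun
  fun_prop

theorem volume_map_mulVec {B : Matrix (Fin n) (Fin n) ℝ} (hB : B.det ≠ 0) :
    Measure.map (fun x => B *ᵥ x) (volume : Measure (Fin n → ℝ)) =
      ENNReal.ofReal |B.det⁻¹| • volume :=
  Real.map_matrix_volume_pi_eq_smul_volume_pi hB

/-- The substitution `y = Bx` separates the variables. Writing the linear term as `Ma` makes the
constant `g` independent of `a`; its square is recorded, and the sign is settled later. -/
theorem exists_gaussian_integral {M : Matrix (Fin n) (Fin n) ℂ} (hM : IsAccretive M)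
    (hs : M.IsSymm) : ∃ g : ℂ, g ^ 2 * M.det = (2 * Real.pi) ^ n ∧ ∀ a : Fin n → ℂ,
      Integrable (gaussFun M (M *ᵥ a)) ∧
      ∫ x, gaussFun M (M *ᵥ a) x = g * Complex.exp (1 / 2 * (a ⬝ᵥ M *ᵥ a)) := by
  obtain ⟨B, d, hB, hBM⟩ := exists_congr_diagonal hM hs
  set k : Fin n → ℂ := fun i => 1 + Complex.I * d i with hk
  have hk0 : ∀ i, 0 < (k i / 2).re := fun i => by simp [hk]
  have hk1 : ∀ i, k i ≠ 0 := fun i h => by have := hk0 i; simp [h] at this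
  have hpi : (Real.pi : ℂ) ≠ 0 := by exact_mod_cast Real.pi_ne_zero
  let F : (Fin n → ℂ) → (Fin n → ℝ) → ℂ := fun c y =>
    Complex.exp (-∑ i, k i / 2 * (y i : ℂ) ^ 2 + ∑ i, c i * y i)
  have hFc : ∀ c, Continuous (F c) := fun c => by fun_prop
  have hbil : ∀ u v : Fin n → ℂ, u ⬝ᵥ M *ᵥ v =
      ∑ i, k i * (B.map Complex.ofReal *ᵥ u) i * (B.map Complex.ofReal *ᵥ v) i := by
    intro u v
    rw [hBM, ← mulVec_mulVec, ← mulVec_mulVec, dotProduct_mulVec, vecMul_transpose]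
    simp only [dotProduct, mulVec_diagonal]
    exact Finset.sum_congr rfl fun i _ => by ring
  have hF : ∀ a, gaussFun M (M *ᵥ a) =
      fun x => F (fun i => k i * (B.map Complex.ofReal *ᵥ a) i) (B *ᵥ x) := by
    intro a
    ext x
    simp only [gaussFun, F]
    rw [dotProduct_comm (M *ᵥ a), hbil, hbil, cvec_mulVec]
    congr 2
    · rw [Finset.mul_sum, ← Finset.sum_neg_distrib]
      exact Finset.sum_congr rfl fun i _ => by simp only [cvec]; ring
    · exact Finset.sum_congr rfl fun i _ => by simp only [cvec]; ring
  have hmeas : Measurable fun x : Fin n → ℝ => B *ᵥ x :=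
    (Continuous.matrix_mulVec continuous_const continuous_id).measurable
  -- The Jacobian of `y = Bx` times the one-dimensional integrals `∫ exp(-kᵢ y²/2) dy`.
  refine ⟨(|B.det⁻¹| : ℝ) * ∏ i, (Real.pi / (k i / 2)) ^ (1 / 2 : ℂ), ?_, fun a => ?_⟩
  · have h1 : M.det = (B.det : ℂ) ^ 2 * ∏ i, k i := by
      rw [hBM, det_mul, det_mul, det_transpose, det_diagonal]
      have : (B.map Complex.ofReal).det = (B.det : ℂ) := (Complex.ofRealHom.map_det B).symm
      rw [this]; ring
    have h2 : (((|B.det⁻¹| : ℝ) : ℂ)) ^ 2 * (B.det : ℂ) ^ 2 = 1 := by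
      rw [← Complex.ofReal_pow, sq_abs]
      have : (B.det : ℂ) ≠ 0 := by exact_mod_cast hB
      push_cast; field_simp
    have h3 : (∏ i, (Real.pi / (k i / 2)) ^ (1 / 2 : ℂ)) ^ 2 * ∏ i, k i =
        (2 * Real.pi : ℂ) ^ n := by
      rw [← Finset.prod_pow, ← Finset.prod_mul_distrib]
      rw [Finset.prod_congr rfl (g := fun _ => (2 * Real.pi : ℂ))]
      · simp
      · intro i _
        have := hk1 i
        rw [← Complex.cpow_nat_mul]
        norm_num
        field_simp
    rw [h1, mul_pow]
    linear_combination (∏ i, (Real.pi / (k i / 2)) ^ (1 / 2 : ℂ)) ^ 2 * (∏ i, k i) * h2 + h3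
  · rw [hF a]
    set c : Fin n → ℂ := fun i => k i * (B.map Complex.ofReal *ᵥ a) i with hc
    have hint : Integrable (F c) := GaussianFourier.integrable_cexp_neg_sum_mul_add hk0 c
    constructor
    · have h : Integrable (F c) (Measure.map (fun x => B *ᵥ x) volume) := by
        rw [volume_map_mulVec hB]
        exact hint.smul_measure ENNReal.ofReal_ne_top
      exact h.comp_measurable hmeas
    · rw [← integral_map hmeas.aemeasurable (f := F c) (hFc c).aestronglyMeasurable,
        volume_map_mulVec hB, integral_smul_measure,
        GaussianFourier.integral_cexp_neg_sum_mul_add hk0 c, ENNReal.toReal_ofReal (abs_nonneg _),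
        Complex.real_smul, mul_assoc]
      congr 1
      rw [Finset.prod_mul_distrib, ← Complex.exp_sum, hbil, Finset.mul_sum]
      congr 2
      refine Finset.sum_congr rfl fun i _ => ?_
      have := hk1 i
      simp only [hc]
      field_simp
      ring

theorem re_star_quad_smul_one_add_smul (M : Matrix (Fin n) (Fin n) ℂ) (s t : ℝ)
    (v : Fin n → ℂ) :
    (star v ⬝ᵥ ((s : ℂ) • (1 : Matrix (Fin n) (Fin n) ℂ) + (t : ℂ) • M) *ᵥ v).re =
      s * nsq v + t * (star v ⬝ᵥ M *ᵥ v).re := by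
  rw [add_mulVec, smul_mulVec, smul_mulVec, one_mulVec, dotProduct_add, dotProduct_smul,
    dotProduct_smul, star_dotProduct_self]
  simp

theorem isAccretive_one : IsAccretive (1 : Matrix (Fin n) (Fin n) ℂ) := fun v hv => by
  rw [one_mulVec, star_dotProduct_self, Complex.ofReal_re]
  exact nsq_pos hv

theorem IsAccretive.segment {M : Matrix (Fin n) (Fin n) ℂ} (hM : IsAccretive M) {t : ℝ}
    (ht : t ∈ Set.Icc (0 : ℝ) 1) :
    IsAccretive (((1 - t : ℝ) : ℂ) • (1 : Matrix (Fin n) (Fin n) ℂ) + (t : ℂ) • M) :=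
  fun v hv => by
    rw [re_star_quad_smul_one_add_smul]
    have h1 := nsq_pos hv
    have h2 := hM v hv
    rcases eq_or_lt_of_le ht.1 with h | h
    · rw [← h]; simpa using h1
    · have := mul_pos h h2
      have := mul_nonneg (sub_nonneg.2 ht.2) h1.le
      linarith

theorem norm_gaussFun_zero (M : Matrix (Fin n) (Fin n) ℂ) (x : Fin n → ℝ) :
    ‖gaussFun M 0 x‖ = Real.exp (-(1 / 2) * (star (cvec x) ⬝ᵥ M *ᵥ cvec x).re) := by
  rw [gaussFun, Complex.norm_exp, star_cvec, zero_dotProduct, add_zero]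
  congr 1
  simp

theorem integral_gaussFun_one :
    ∫ x, gaussFun (1 : Matrix (Fin n) (Fin n) ℂ) 0 x = ((√(2 * Real.pi) ^ n : ℝ) : ℂ) := by
  have h := GaussianFourier.integral_cexp_neg_sum_mul_add (ι := Fin n) (b := fun _ => 1 / 2)
    (fun _ => by norm_num) 0
  have h1 : ((Real.pi : ℂ) / (1 / 2)) ^ (1 / 2 : ℂ) = ((√(2 * Real.pi) : ℝ) : ℂ) := by
    rw [Real.sqrt_eq_rpow, Complex.ofReal_cpow (by positivity)]
    push_cast
    congr 1
    ring
  rw [Finset.prod_congr rfl (g := fun _ => ((√(2 * Real.pi) : ℝ) : ℂ))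
    (fun i _ => by rw [h1]; simp)] at h
  rw [Finset.prod_const, Finset.card_univ, Fintype.card_fin] at h
  push_cast
  rw [← h]
  congr 1
  ext x
  simp only [gaussFun, one_mulVec, dotProduct, cvec]
  congr 1
  simp only [Finset.mul_sum, ← Finset.sum_neg_distrib]
  simp
  exact Finset.sum_congr rfl fun i _ => by ring

/-- Congruence does not preserve eigenvalues, so the diagonal form does not show the branch. Along
the segment from `I` to `M`, integral times square root is continuous and its square is the constant
`(2π)^n`; the value at `I` decides the sign. -/
theorem integral_gaussFun_zero {M : Matrix (Fin n) (Fin n) ℂ} (hM : IsAccretive M)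
    (hs : M.IsSymm) :
    (∫ x, gaussFun M 0 x) * detSqrt M = ((√(2 * Real.pi) ^ n : ℝ) : ℂ) := by
  set P : ℝ → Matrix (Fin n) (Fin n) ℂ := fun t =>
    ((1 - t : ℝ) : ℂ) • (1 : Matrix (Fin n) (Fin n) ℂ) + (t : ℂ) • M with hP
  have hPs : ∀ t, (P t).IsSymm := fun t => by
    simp only [hP, IsSymm, transpose_add, transpose_smul, transpose_one, hs.eq]
  have hint : ∀ {N : Matrix (Fin n) (Fin n) ℂ}, IsAccretive N → N.IsSymm →
      Integrable (gaussFun N 0) ∧ (∫ x, gaussFun N 0 x) ^ 2 * N.det = (2 * Real.pi) ^ n := by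
    intro N hN hNs
    obtain ⟨g, hg, h⟩ := exists_gaussian_integral hN hNs
    have h0 := h 0
    rw [mulVec_zero, zero_dotProduct, mul_zero, Complex.exp_zero, mul_one] at h0
    exact ⟨h0.1, by rw [h0.2, hg]⟩
  set r : ℝ → ℂ := fun t => (M.charpoly.roots.map fun a =>
    (((1 - t : ℝ) : ℂ) + (t : ℂ) * a) ^ (1 / 2 : ℂ)).prod with hr
  have hr2 : ∀ t, r t ^ 2 = (P t).det := fun t => by
    rw [hP, det_smul_one_add_smul, hr, ← Multiset.prod_map_pow]
    simp
  have hrc : ContinuousOn r (Set.Icc 0 1) := by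
    refine continuousOn_multiset_prod _ fun a ha => ?_
    have hre := hM.re_pos_of_mem_roots ha
    refine ContinuousOn.cpow_const (by fun_prop) fun t ht => Or.inl ?_
    simp only [Complex.add_re, Complex.ofReal_re, Complex.re_ofReal_mul]
    rcases eq_or_lt_of_le ht.1 with h | h
    · rw [← h]; simp
    · have := mul_pos h hre
      linarith [ht.2]
  -- The exponent is a convex combination of those at the endpoints, so the larger endpoint
  -- Gaussian, hence the sum of both, dominates.
  have hGc : ContinuousOn (fun t => ∫ x, gaussFun (P t) 0 x) (Set.Icc 0 1) := by
    refine continuousOn_of_dominated (bound := fun x =>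
      ‖gaussFun (1 : Matrix (Fin n) (Fin n) ℂ) 0 x‖ + ‖gaussFun M 0 x‖)
      (fun t _ => (continuous_gaussFun _ _).aestronglyMeasurable) (fun t ht => ?_)
      ((hint isAccretive_one isSymm_one).1.norm.add (hint hM hs).1.norm) ?_
    · refine Filter.Eventually.of_forall fun x => ?_
      rw [norm_gaussFun_zero, norm_gaussFun_zero, norm_gaussFun_zero,
        re_star_quad_smul_one_add_smul, one_mulVec, star_dotProduct_self, Complex.ofReal_re]
      set p := nsq (cvec x)
      set q := (star (cvec x) ⬝ᵥ M *ᵥ cvec x).re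
      have h1 := Real.exp_pos (-(1 / 2) * p)
      have h2 := Real.exp_pos (-(1 / 2) * q)
      rcases le_total p q with h | h
      · have : Real.exp (-(1 / 2) * ((1 - t) * p + t * q)) ≤ Real.exp (-(1 / 2) * p) :=
          Real.exp_le_exp.2 (by nlinarith [ht.1])
        linarith
      · have : Real.exp (-(1 / 2) * ((1 - t) * p + t * q)) ≤ Real.exp (-(1 / 2) * q) :=
          Real.exp_le_exp.2 (by nlinarith [ht.2])
        linarith
    · refine Filter.Eventually.of_forall fun x => Continuous.continuousOn ?_
      simp only [gaussFun, hP]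
      fun_prop
  have hpos : (((√(2 * Real.pi) ^ n : ℝ) : ℂ)) ≠ 0 := by
    have : 0 < √(2 * Real.pi) := Real.sqrt_pos.2 (by positivity)
    exact_mod_cast (pow_pos this n).ne'
  have hsq : (((√(2 * Real.pi) ^ n : ℝ) : ℂ)) ^ 2 = (2 * Real.pi) ^ n := by
    rw [← Complex.ofReal_pow, ← pow_mul, mul_comm n 2, pow_mul, Real.sq_sqrt (by positivity)]
    push_cast; rfl
  have key := isPreconnected_Icc.eq_of_sq_eq (S := Set.Icc (0 : ℝ) 1) (hGc.mul hrc)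
    (continuousOn_const (c := ((√(2 * Real.pi) ^ n : ℝ) : ℂ))) (fun t ht => by
      simp only [Pi.pow_apply, Pi.mul_apply]
      rw [mul_pow, hr2, (hint (hM.segment ht) (hPs t)).2, hsq]) (fun _ => hpos)
    (y := 0) (by simp) (by
      simp only [Pi.mul_apply, hP, hr]
      simp [integral_gaussFun_one])
  have h1 := key (x := 1) (by simp)
  simpa [hP, hr, detSqrt] using h1

/-- The Gaussian integral with a complex symmetric matrix. -/
theorem gaussian_integral {M : Matrix (Fin n) (Fin n) ℂ} (hM : IsAccretive M)
    (hs : M.IsSymm) (a : Fin n → ℂ) :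
    Integrable (gaussFun M (M *ᵥ a)) ∧
      ∫ x, gaussFun M (M *ᵥ a) x =
        ((√(2 * Real.pi) ^ n : ℝ) : ℂ) / detSqrt M * Complex.exp (1 / 2 * (a ⬝ᵥ M *ᵥ a)) := by
  obtain ⟨g, -, h⟩ := exists_gaussian_integral hM hs
  have h0 := (h 0).2
  rw [mulVec_zero, zero_dotProduct, mul_zero, Complex.exp_zero, mul_one] at h0
  refine ⟨(h a).1, ?_⟩
  rw [(h a).2, ← integral_gaussFun_zero hM hs, h0, mul_div_cancel_right₀ _ (detSqrt_ne_zero hM)]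

/-! ### The Gaussian measure on `ℂⁿ` -/

/-- The density of the Gaussian measure. -/
def gaussWeight (z : Fin n → ℂ) : ℝ := (Real.pi ^ n)⁻¹ * Real.exp (-nsq z)

theorem gaussWeight_pos (z : Fin n → ℂ) : 0 < gaussWeight z := by
  unfold gaussWeight; positivity

theorem continuous_nsq : Continuous (nsq (n := n)) := by unfold nsq; fun_prop

theorem continuous_gaussWeight : Continuous (gaussWeight (n := n)) := by
  have := continuous_nsq (n := n)
  unfold gaussWeight; fun_prop

theorem gaussMeasure_eq : gaussMeasure n =
    (volume : Measure (Fin n → ℂ)).withDensity fun z => ENNReal.ofReal (gaussWeight z) := rfl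

theorem integrable_gaussMeasure_iff {f : (Fin n → ℂ) → ℂ} :
    Integrable f (gaussMeasure n) ↔ Integrable fun z => gaussWeight z • f z := by
  rw [gaussMeasure_eq, integrable_withDensity_iff_integrable_smul'
    continuous_gaussWeight.measurable.ennreal_ofReal (by simp)]
  simp only [ENNReal.toReal_ofReal (gaussWeight_pos _).le]

theorem integral_gaussMeasure (f : (Fin n → ℂ) → ℂ) :
    ∫ z, f z ∂(gaussMeasure n) = ∫ z, gaussWeight z • f z := by
  rw [gaussMeasure_eq, integral_withDensity_eq_integral_toReal_smul
    continuous_gaussWeight.measurable.ennreal_ofReal (by simp)]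
  simp only [ENNReal.toReal_ofReal (gaussWeight_pos _).le]

theorem integrable_exp_neg_nsq {δ : ℝ} (hδ : 0 < δ) :
    Integrable fun z : Fin n → ℂ => Real.exp (-δ * nsq z) := by
  have h1 : Integrable fun z : ℂ => Real.exp (-δ * ‖z‖ ^ 2) := by
    have := (GaussianFourier.integrable_cexp_neg_mul_sq_norm_add (V := ℂ) (b := (δ : ℂ))
      (by simpa using hδ) 0 0).re
    refine this.congr (Filter.Eventually.of_forall fun z => ?_)
    simp only [zero_mul, add_zero]
    rw [show (-(δ : ℂ) * (‖z‖ : ℂ) ^ 2) = ((-δ * ‖z‖ ^ 2 : ℝ) : ℂ) by push_cast; rfl,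
      ← Complex.ofReal_exp]
    exact Complex.ofReal_re _
  refine (Integrable.fintype_prod (f := fun (_ : Fin n) (z : ℂ) => Real.exp (-δ * ‖z‖ ^ 2))
    fun _ => h1).congr (Filter.Eventually.of_forall fun z => ?_)
  simp only [nsq, Finset.mul_sum, Real.exp_sum]

theorem integral_gaussWeight : ∫ z : Fin n → ℂ, gaussWeight z = 1 := by
  have h := GaussianFourier.integral_rexp_neg_mul_sq_norm (V := ℂ) (b := 1) one_pos
  have h2 := integral_fintype_prod_volume_eq_pow (ι := Fin n) (E := ℂ)
    (fun z : ℂ => Real.exp (-1 * ‖z‖ ^ 2))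
  rw [h, Complex.finrank_real_complex, Fintype.card_fin] at h2
  simp only [gaussWeight]
  rw [integral_const_mul]
  have h3 : ∀ z : Fin n → ℂ, Real.exp (-nsq z) = ∏ i, Real.exp (-1 * ‖z i‖ ^ 2) := fun z => by
    rw [← Real.exp_sum, nsq, ← Finset.mul_sum, neg_one_mul]
  simp only [h3]
  rw [h2]
  norm_num

theorem integral_const_gaussMeasure (c : ℂ) : ∫ _, c ∂(gaussMeasure n) = c := by
  rw [integral_gaussMeasure, integral_smul_const, integral_gaussWeight, one_smul]

theorem exp_quadratic_bound {k : ℝ} (hk : k < 1) (m s : ℝ) :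
    -s ^ 2 + (k * s ^ 2 + m * s) ≤ -((1 - k) / 2) * s ^ 2 + m ^ 2 / (2 * (1 - k)) := by
  have h : 0 < 1 - k := by linarith
  have : m * s ≤ (1 - k) / 2 * s ^ 2 + m ^ 2 / (2 * (1 - k)) := by
    rw [← sub_nonneg]
    have : (1 - k) / 2 * s ^ 2 + m ^ 2 / (2 * (1 - k)) - m * s =
        ((1 - k) * s - m) ^ 2 / (2 * (1 - k)) := by field_simp; ring
    rw [this]; positivity
  linarith

/-- The weight `exp(-|z|²)` beats quadratic growth with `k < 1`, and completing the square absorbs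
the linear term into half of the remaining gap `1 - k`. -/
theorem integrable_gaussMeasure_of_le {f : (Fin n → ℂ) → ℂ} (hf : Continuous f) {C k m : ℝ}
    (hk : k < 1) (h : ∀ z, ‖f z‖ ≤ C * Real.exp (k * nsq z + m * √(nsq z))) :
    Integrable f (gaussMeasure n) := by
  rw [integrable_gaussMeasure_iff]
  have hC : 0 ≤ C := nonneg_of_mul_nonneg_left ((norm_nonneg _).trans (h 0)) (Real.exp_pos _)
  refine Integrable.mono' ((integrable_exp_neg_nsq (δ := (1 - k) / 2) (by linarith)).const_mul
    ((Real.pi ^ n)⁻¹ * C * Real.exp (m ^ 2 / (2 * (1 - k)))))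
    (continuous_gaussWeight.smul hf).aestronglyMeasurable (Filter.Eventually.of_forall fun z => ?_)
  rw [norm_smul, Real.norm_of_nonneg (gaussWeight_pos z).le]
  refine (mul_le_mul_of_nonneg_left (h z) (gaussWeight_pos z).le).trans ?_
  have hb := exp_quadratic_bound hk m (√(nsq z))
  rw [Real.sq_sqrt (nsq_nonneg z)] at hb
  have := Real.exp_le_exp.2 hb
  rw [Real.exp_add, Real.exp_add (-((1 - k) / 2) * _)] at this
  unfold gaussWeight
  have hp : 0 ≤ (Real.pi ^ n)⁻¹ * C := by positivity
  have := mul_le_mul_of_nonneg_left this hp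
  linarith

theorem measurePreserving_gaussMeasure (e : ℂ ≃ₗᵢ[ℝ] ℂ) :
    MeasurePreserving (fun (z : Fin n → ℂ) i => e (z i)) (gaussMeasure n) (gaussMeasure n) := by
  have hv : MeasurePreserving (fun (z : Fin n → ℂ) i => e (z i)) volume volume :=
    volume_preserving_pi fun _ => e.measurePreserving
  refine ⟨hv.measurable, Measure.ext fun s hs => ?_⟩
  have hw := continuous_gaussWeight (n := n).measurable.ennreal_ofReal
  rw [Measure.map_apply hv.measurable hs, gaussMeasure_eq,
    withDensity_apply _ (hv.measurable hs), withDensity_apply _ hs,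
    ← hv.setLIntegral_comp_preimage hs hw]
  simp [gaussWeight, nsq]

theorem integral_comp_star (f : (Fin n → ℂ) → ℂ) (hf : Continuous f) :
    ∫ z, f (star z) ∂(gaussMeasure n) = ∫ z, f z ∂(gaussMeasure n) := by
  have h := measurePreserving_gaussMeasure (n := n) Complex.conjLIE
  rw [← h.map_eq, integral_map h.measurable.aemeasurable hf.aestronglyMeasurable, h.map_eq]
  rfl

theorem integrable_comp_star {f : (Fin n → ℂ) → ℂ}
    (hi : Integrable f (gaussMeasure n)) :
    Integrable (fun z => f (star z)) (gaussMeasure n) := by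
  have h := measurePreserving_gaussMeasure (n := n) Complex.conjLIE
  exact h.integrable_comp_of_integrable hi

instance : IsFiniteMeasure (gaussMeasure n) := by
  have : Integrable (fun _ => (1 : ℂ)) (gaussMeasure n) :=
    integrable_gaussMeasure_of_le continuous_const (C := 1) (k := 0) (m := 0) one_pos (by simp)
  exact (integrable_const_iff.1 this).resolve_left one_ne_zero

/-! ### Mean value and reproducing properties -/

/-- The mean value property of entire functions for the Gaussian measure. -/
theorem integral_gaussMeasure_of_differentiable {f : (Fin n → ℂ) → ℂ} (hf : Differentiable ℂ f)
    (hi : Integrable f (gaussMeasure n)) : ∫ z, f z ∂(gaussMeasure n) = f 0 := by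
  have hfc := hf.continuous
  have hrot : ∀ θ : ℝ, MeasurePreserving (fun z : Fin n → ℂ => circleMap 0 1 θ • z)
      (gaussMeasure n) (gaussMeasure n) := fun θ => by
    convert measurePreserving_gaussMeasure (n := n) (rotation (Circle.exp θ)) using 1
    ext z i
    simp [circleMap]
  have hint : ∀ θ : ℝ, Integrable (fun z : Fin n → ℂ => f (circleMap 0 1 θ • z))
      (gaussMeasure n) := fun θ => (hrot θ).integrable_comp_of_integrable hi
  have hval : ∀ θ : ℝ, ∫ z, f (circleMap 0 1 θ • z) ∂(gaussMeasure n) =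
      ∫ z, f z ∂(gaussMeasure n) := fun θ => by
    conv_rhs => rw [← (hrot θ).map_eq, integral_map (hrot θ).measurable.aemeasurable
      hfc.aestronglyMeasurable]
  have hvaln : ∀ θ : ℝ, ∫ z, ‖f (circleMap 0 1 θ • z)‖ ∂(gaussMeasure n) =
      ∫ z, ‖f z‖ ∂(gaussMeasure n) := fun θ => by
    conv_rhs => rw [← (hrot θ).map_eq, integral_map (hrot θ).measurable.aemeasurable
      hfc.norm.aestronglyMeasurable]
  -- The one-variable mean value property on the complex line through `z`; averaging the
  -- rotation-invariant integral over `θ` then replaces `f` by `f 0`.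
  have hmean : ∀ z : Fin n → ℂ, ∫ θ in Set.Ioc 0 (2 * Real.pi), f (circleMap 0 1 θ • z) =
      ((2 * Real.pi : ℝ) : ℂ) * f 0 := fun z => by
    have hd : Differentiable ℂ fun ζ : ℂ => f (ζ • z) := hf.comp (by fun_prop)
    have := (hd.diffContOnCl (s := Metric.ball 0 |1|)).circleAverage
    rw [Real.circleAverage, intervalIntegral.integral_of_le (by positivity), zero_smul] at this
    rw [← this, Complex.real_smul]
    push_cast
    field_simp
  have hcont : Continuous fun p : ℝ × (Fin n → ℂ) => f (circleMap 0 1 p.1 • p.2) := by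
    have := continuous_circleMap (0 : ℂ) 1
    fun_prop
  have hprod : Integrable (Function.uncurry fun (θ : ℝ) (z : Fin n → ℂ) =>
      f (circleMap 0 1 θ • z))
      ((volume.restrict (Set.Ioc 0 (2 * Real.pi))).prod (gaussMeasure n)) := by
    refine (integrable_prod_iff hcont.aestronglyMeasurable).2
      ⟨Filter.Eventually.of_forall hint, ?_⟩
    simp only [hvaln]
    exact integrable_const _
  have hswap := integral_integral_swap hprod
  simp only [hval, hmean, integral_const_gaussMeasure] at hswap
  rw [setIntegral_const, Real.volume_real_Ioc_of_le (by positivity), sub_zero,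
    Complex.real_smul] at hswap
  exact mul_left_cancel₀ (by exact_mod_cast (by positivity : (2 * Real.pi) ≠ 0)) hswap

/-- Translation by `s` trades the antiholomorphic factor for the holomorphic `exp(-u·s̄)`, which
reduces the reproducing property to the mean value property at `u = 0`. -/
theorem gaussWeight_add_smul (u s : Fin n → ℂ) (c : ℂ) :
    gaussWeight (u + s) • (Complex.exp (star (u + s) ⬝ᵥ s) * c) =
      gaussWeight u • (Complex.exp (-(u ⬝ᵥ star s)) * c) := by
  have h : (nsq (u + s) : ℂ) = nsq u + star u ⬝ᵥ s + u ⬝ᵥ star s + nsq s := by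
    rw [← star_dotProduct_self, ← star_dotProduct_self, ← star_dotProduct_self, star_add,
      add_dotProduct, dotProduct_add, dotProduct_add, dotProduct_comm u]
    ring
  simp only [gaussWeight, Complex.real_smul]
  push_cast
  rw [h, star_add, add_dotProduct, star_dotProduct_self, mul_assoc, mul_assoc,
    ← mul_assoc (Complex.exp _),
    ← mul_assoc (Complex.exp _), ← Complex.exp_add, ← Complex.exp_add]
  congr 3
  ring

/-- The reproducing property of the Bargmann-Fock kernel. -/
theorem integral_exp_star_dotProduct_mul {f : (Fin n → ℂ) → ℂ} (hf : Differentiable ℂ f)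
    (s : Fin n → ℂ)
    (hi : Integrable (fun z => Complex.exp (star z ⬝ᵥ s) * f z) (gaussMeasure n)) :
    ∫ z, Complex.exp (star z ⬝ᵥ s) * f z ∂(gaussMeasure n) = f s := by
  have hd : Differentiable ℂ fun u : Fin n → ℂ => Complex.exp (-(u ⬝ᵥ star s)) * f (u + s) := by
    refine Differentiable.mul ?_ (hf.comp (by fun_prop))
    simp only [dotProduct]
    fun_prop
  rw [integrable_gaussMeasure_iff] at hi
  have hi' := hi.comp_add_right s
  simp only [gaussWeight_add_smul] at hi'
  have := integral_gaussMeasure_of_differentiable hd (integrable_gaussMeasure_iff.2 hi')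
  rw [integral_gaussMeasure] at this ⊢
  rw [← integral_add_right_eq_self _ s]
  simp only [gaussWeight_add_smul]
  rw [this]
  simp

/-! ### The Bargmann form of the squeezed state -/

variable {A : Matrix (Fin n) (Fin n) ℂ}

/-- The Gaussian `z ↦ exp(½ z·Az)`. -/
def expQuad (A : Matrix (Fin n) (Fin n) ℂ) (z : Fin n → ℂ) : ℂ :=
  Complex.exp ((z ⬝ᵥ A *ᵥ z) / 2)

theorem differentiable_quad (A : Matrix (Fin n) (Fin n) ℂ) :
    Differentiable ℂ fun z : Fin n → ℂ => z ⬝ᵥ A *ᵥ z := by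
  simp only [dotProduct, mulVec]
  fun_prop

theorem differentiable_expQuad (A : Matrix (Fin n) (Fin n) ℂ) :
    Differentiable ℂ (expQuad A) := by
  have := differentiable_quad A
  unfold expQuad
  fun_prop

theorem norm_expQuad_le (A : Matrix (Fin n) (Fin n) ℂ) (z : Fin n → ℂ) :
    ‖expQuad A z‖ ≤
      Real.exp (‖Matrix.toEuclideanCLM (n := Fin n) (𝕜 := ℂ) A‖ / 2 * nsq z) := by
  refine (Complex.norm_exp_le_exp_norm _).trans (Real.exp_le_exp.2 ?_)
  rw [norm_div, Complex.norm_ofNat]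
  linarith [norm_quad_le A z]

theorem star_dotProduct_conjTranspose (A : Matrix (Fin n) (Fin n) ℂ) (w : Fin n → ℂ) :
    star w ⬝ᵥ Aᴴ *ᵥ star w = star (w ⬝ᵥ A *ᵥ w) := by
  rw [star_dotProduct, star_mulVec, star_star, conjTranspose_conjTranspose, ← dotProduct_mulVec]

theorem nsq_star (z : Fin n → ℂ) : nsq (star z) = nsq z := by simp [nsq]

/-- The metaplectic kernel of `ι(A)` as an entire function of `w̄`. -/
def kernelFun (A : Matrix (Fin n) (Fin n) ℂ) (z v : Fin n → ℂ) : ℂ :=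
  (1 - Aᴴ * A).det ^ (1 / 4 : ℂ) *
      Complex.exp (1 / 2 * (z ⬝ᵥ A *ᵥ z) - 1 / 2 * (v ⬝ᵥ Aᴴ *ᵥ v) +
        z ⬝ᵥ ((invSqrt (1 - Aᴴ * A))⁻¹ᵀ *ᵥ v))

theorem differentiable_kernelFun (A : Matrix (Fin n) (Fin n) ℂ) (z : Fin n → ℂ) :
    Differentiable ℂ (kernelFun A z) := by
  have := differentiable_quad Aᴴ
  have h2 : Differentiable ℂ fun v => z ⬝ᵥ ((invSqrt (1 - Aᴴ * A))⁻¹ᵀ *ᵥ v) := by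
    simp only [dotProduct, mulVec]
    fun_prop
  unfold kernelFun
  fun_prop

theorem integrable_kernelFun (hA : A ∈ domainD n) (z : Fin n → ℂ) :
    Integrable (kernelFun A z) (gaussMeasure n) := by
  refine integrable_gaussMeasure_of_le (differentiable_kernelFun A z).continuous
    (C := ‖(1 - Aᴴ * A).det ^ (1 / 4 : ℂ)‖ * Real.exp ‖1 / 2 * (z ⬝ᵥ A *ᵥ z)‖)
    (k := ‖Matrix.toEuclideanCLM (n := Fin n) (𝕜 := ℂ) A‖ / 2)
    (m := √(nsq z) * ‖Matrix.toEuclideanCLM (n := Fin n) (𝕜 := ℂ) (invSqrt (1 - Aᴴ * A))⁻¹ᵀ‖)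
    (by have := hA.2; have := norm_nonneg (Matrix.toEuclideanCLM (n := Fin n) (𝕜 := ℂ) A)
        linarith) fun v => ?_
  rw [kernelFun, norm_mul, mul_assoc, ← Real.exp_add]
  refine mul_le_mul_of_nonneg_left ((Complex.norm_exp_le_exp_norm _).trans
    (Real.exp_le_exp.2 ?_)) (norm_nonneg _)
  refine (norm_add_le _ _).trans ?_
  rw [← add_assoc]
  refine add_le_add ((norm_sub_le _ _).trans (add_le_add le_rfl ?_)) ?_
  · have := star_dotProduct_conjTranspose A (star v)
    rw [star_star] at this
    rw [this, norm_mul, norm_star]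
    have h := norm_quad_le A (star v)
    rw [nsq_star] at h
    norm_num
    linarith
  · refine (norm_dotProduct_le _ _).trans ?_
    rw [mul_assoc]
    exact mul_le_mul_of_nonneg_left (nsq_mulVec_le _ _) (Real.sqrt_nonneg _)

theorem integrable_metaplecticKernel_iota (hA : A ∈ domainD n) (z : Fin n → ℂ) :
    Integrable (fun w => metaplecticKernel (iota A) z w) (gaussMeasure n) := by
  simp only [metaplecticKernel_iota hA]
  exact integrable_comp_star (integrable_kernelFun hA z)

theorem squeezedState_eq (hA : A ∈ domainD n) (z : Fin n → ℂ) :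
    squeezedState A z = (1 - Aᴴ * A).det ^ (1 / 4 : ℂ) * expQuad A z := by
  simp only [squeezedState, metaplecticOp, metaplecticKernel_iota hA, mul_one]
  have h := integral_comp_star (kernelFun A z) (differentiable_kernelFun A z).continuous
  rw [integral_gaussMeasure_of_differentiable (differentiable_kernelFun A z)
    (integrable_kernelFun hA z)] at h
  simp only [kernelFun] at h
  rw [h, expQuad]
  simp only [mulVec_zero, dotProduct_zero]
  congr 2
  ring

theorem squeezedState_mem_fock (hA : A ∈ domainD n) : squeezedState A ∈ fock n := by
  have he : squeezedState A = fun z => (1 - Aᴴ * A).det ^ (1 / 4 : ℂ) * expQuad A z :=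
    funext (squeezedState_eq hA)
  have hd : Differentiable ℂ (squeezedState A) := by
    rw [he]; exact (differentiable_expQuad A).const_mul _
  refine ⟨hd, ?_⟩
  have h : Integrable (fun z => squeezedState A z ^ 2) (gaussMeasure n) := by
    refine integrable_gaussMeasure_of_le (hd.continuous.pow 2)
      (C := ‖(1 - Aᴴ * A).det ^ (1 / 4 : ℂ)‖ ^ 2) (m := 0) hA.2 fun z => ?_
    rw [squeezedState_eq hA, norm_pow, norm_mul, mul_pow, zero_mul, add_zero]
    refine mul_le_mul_of_nonneg_left ?_ (by positivity)
    refine (pow_le_pow_left₀ (norm_nonneg _) (norm_expQuad_le A z) 2).trans ?_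
    rw [← Real.exp_nat_mul]
    refine le_of_eq (congrArg _ ?_)
    push_cast; ring
  simpa only [norm_pow] using h.norm

/-! ### The matrix `Z`, its real part and the phase -/

section Schrodinger

theorem isAccretive_one_add (hA : A ∈ domainD n) : IsAccretive (1 + A) := fun v hv => by
  rw [add_mulVec, one_mulVec, dotProduct_add, star_dotProduct_self, Complex.add_re,
    Complex.ofReal_re]
  have h1 := (Complex.abs_re_le_norm _).trans (norm_dotProduct_le (star v) (A *ᵥ v))
  rw [nsq_star] at h1
  have h2 := Real.sqrt_lt_sqrt (nsq_nonneg _) (nsq_mulVec_lt hA hv)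
  have h3 := Real.sqrt_pos.2 (nsq_pos hv)
  have h4 := Real.mul_self_sqrt (nsq_nonneg v)
  have h5 := mul_lt_mul_of_pos_left h2 h3
  have := neg_abs_le (star v ⬝ᵥ A *ᵥ v).re
  linarith

theorem one_add_isSymm (hA : A ∈ domainD n) : (1 + A).IsSymm := by
  rw [IsSymm, transpose_add, transpose_one, hA.1.eq]

theorem matZ_mul_one_add (hA : A ∈ domainD n) : matZ A * (1 + A) = 1 - A :=
  nonsing_inv_mul_cancel_right _ _ ((isUnit_iff_isUnit_det _).1 (isUnit_one_add hA))

theorem one_add_matZ (hA : A ∈ domainD n) : 1 + matZ A = (2 : ℂ) • (1 + A)⁻¹ := by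
  have hu := (isUnit_iff_isUnit_det _).1 (isUnit_one_add hA)
  have h : 1 + matZ A = (1 + A) * (1 + A)⁻¹ + (1 - A) * (1 + A)⁻¹ := by
    rw [mul_nonsing_inv _ hu, matZ]
  rw [h, ← add_mul, add_add_sub_cancel, ← two_smul ℂ (1 : Matrix (Fin n) (Fin n) ℂ),
    smul_mul_assoc, one_mul]

theorem matZ_isSymm (hA : A ∈ domainD n) : (matZ A).IsSymm := by
  have h : matZ A = (2 : ℂ) • (1 + A)⁻¹ - 1 := by rw [← one_add_matZ hA]; abel
  rw [IsSymm, h, transpose_sub, transpose_smul, transpose_nonsing_inv, transpose_one,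
    (one_add_isSymm hA).eq]

/-- With `v = (I + A) y`, the real part of `v* Z v` is `|y|² - |Ay|²`. -/
theorem isAccretive_matZ (hA : A ∈ domainD n) : IsAccretive (matZ A) := fun v hv => by
  have hu := (isUnit_iff_isUnit_det _).1 (isUnit_one_add hA)
  obtain ⟨y, rfl⟩ : ∃ y, (1 + A) *ᵥ y = v :=
    ⟨(1 + A)⁻¹ *ᵥ v, by rw [mulVec_mulVec, mul_nonsing_inv _ hu, one_mulVec]⟩
  have hy : y ≠ 0 := fun h => hv (by rw [h, mulVec_zero])
  rw [mulVec_mulVec, matZ_mul_one_add hA, sub_mulVec, add_mulVec, one_mulVec, star_add,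
    add_dotProduct, dotProduct_sub, dotProduct_sub, star_dotProduct_self, star_dotProduct_self]
  have h : star (A *ᵥ y) ⬝ᵥ y = star (star y ⬝ᵥ A *ᵥ y) := by
    rw [star_dotProduct]
  rw [h]
  have := nsq_mulVec_lt hA hy
  simp
  linarith

theorem isAccretive_one_add_matZ (hA : A ∈ domainD n) : IsAccretive (1 + matZ A) := fun v hv => by
  rw [add_mulVec, dotProduct_add, Complex.add_re]
  exact add_pos (isAccretive_one v hv) (isAccretive_matZ hA v hv)

theorem one_add_matZ_isSymm (hA : A ∈ domainD n) : (1 + matZ A).IsSymm := by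
  rw [IsSymm, transpose_add, transpose_one, (matZ_isSymm hA).eq]

theorem matX_posDef (hA : A ∈ domainD n) : (matX A).PosDef :=
  (isAccretive_matZ hA).posDef_re (matZ_isSymm hA)

theorem two_smul_matX (hA : A ∈ domainD n) :
    (2 : ℂ) • (matX A).map Complex.ofReal = matZ A + (matZ A)ᴴ := by
  ext i j
  have := congrFun (congrFun (matZ_isSymm hA).eq i) j
  rw [transpose_apply] at this
  apply Complex.ext <;> simp [matX, this]
  ring

/-- Since `2X = Z + Z*` by symmetry, multiplying out with `Z (I + A) = I - A` cancels the cross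
terms. Determinants then link `det(I - A*A)` to `det X`. -/
theorem conj_matX (hA : A ∈ domainD n) :
    (1 + A)ᴴ * (matX A).map Complex.ofReal * (1 + A) = 1 - Aᴴ * A := by
  have h1 : (1 + A)ᴴ * (matZ A + (matZ A)ᴴ) * (1 + A) = (2 : ℂ) • (1 - Aᴴ * A) := by
    rw [mul_add (1 + A)ᴴ, add_mul, mul_assoc, matZ_mul_one_add hA, ← conjTranspose_mul,
      matZ_mul_one_add hA]
    simp only [conjTranspose_add, conjTranspose_sub, conjTranspose_one]
    rw [two_smul]
    noncomm_ring
  rw [← two_smul_matX hA, mul_smul_comm, smul_mul_assoc] at h1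
  exact smul_right_injective _ (two_ne_zero (α := ℂ)) h1

theorem det_one_sub (hA : A ∈ domainD n) :
    (1 - Aᴴ * A).det = ((‖(1 + A).det‖ ^ 2 * (matX A).det : ℝ) : ℂ) := by
  rw [← conj_matX hA, det_mul, det_mul, det_conjTranspose]
  have : ((matX A).map Complex.ofReal).det = ((matX A).det : ℂ) :=
    (Complex.ofRealHom.map_det (matX A)).symm
  rw [this]
  push_cast
  rw [← Complex.conj_mul', Complex.star_def]
  ring

theorem isAccretive_two_smul_matX (hA : A ∈ domainD n) :
    IsAccretive ((2 : ℂ) • (matX A).map Complex.ofReal) := fun v hv => by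
  rw [two_smul_matX hA, add_mulVec, dotProduct_add]
  have h : star v ⬝ᵥ (matZ A)ᴴ *ᵥ v = star (star v ⬝ᵥ matZ A *ᵥ v) := by
    rw [star_dotProduct, star_mulVec, conjTranspose_conjTranspose, ← dotProduct_mulVec]
  rw [h]
  have := isAccretive_matZ hA v hv
  simp
  linarith

/-- By `I + Z = 2(I + A)⁻¹`, both the square root and its modulus invert up to the same factor
`2^{n/2}`. -/
theorem phase_eq (hA : A ∈ domainD n) :
    phase A = ((√‖(1 + A).det‖ : ℝ) : ℂ) / detSqrt (1 + A) := by
  have hq := norm_pos_iff.2 (isAccretive_one_add hA).det_ne_zero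
  have h1 := detSqrt_two_smul_inv (isAccretive_one_add hA)
  have hs := detSqrt_ne_zero (isAccretive_one_add hA)
  have h2 : √‖(1 + matZ A).det‖ = √2 ^ n / √‖(1 + A).det‖ := by
    rw [one_add_matZ hA, det_smul, det_nonsing_inv, Ring.inverse_eq_inv', norm_mul, norm_pow,
      norm_inv, Fintype.card_fin, Complex.norm_ofNat, ← div_eq_mul_inv,
      Real.sqrt_div (by positivity)]
    congr 1
    rw [Real.sqrt_eq_iff_mul_self_eq (by positivity) (by positivity), ← mul_pow,
      Real.mul_self_sqrt (by norm_num)]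
  rw [← one_add_matZ hA] at h1
  have h3 : ((√2 ^ n : ℝ) : ℂ) ≠ 0 := by
    have : 0 < √2 := by positivity
    exact_mod_cast (pow_pos this n).ne'
  have h4 : ((√‖(1 + A).det‖ : ℝ) : ℂ) ≠ 0 := by exact_mod_cast (Real.sqrt_pos.2 hq).ne'
  rw [phase, h2, eq_div_of_mul_eq hs h1, Complex.ofReal_div]
  field_simp

theorem norm_phase (hA : A ∈ domainD n) : ‖phase A‖ = 1 := by
  have hq := norm_pos_iff.2 (isAccretive_one_add hA).det_ne_zero
  rw [phase_eq hA, norm_div, Complex.norm_real, Real.norm_of_nonneg (Real.sqrt_nonneg _)]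
  rw [← detSqrt_sq, norm_pow, Real.sqrt_sq (norm_nonneg _)]
  exact div_self (norm_ne_zero_iff.2 (detSqrt_ne_zero (isAccretive_one_add hA)))

/-- The constant in the Schrödinger form. -/
theorem phase_mul (hA : A ∈ domainD n) :
    phase A * ((((matX A).det / Real.pi ^ n) ^ (1 / 4 : ℝ) : ℝ) : ℂ) =
      ((Real.pi ^ (-(n : ℝ) / 4) : ℝ) : ℂ) *
        ((1 - Aᴴ * A).det ^ (1 / 4 : ℂ) / detSqrt (1 + A)) := by
  have hq := norm_pos_iff.2 (isAccretive_one_add hA).det_ne_zero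
  have hX := (matX_posDef hA).det_pos
  have h1 : (1 - Aᴴ * A).det ^ (1 / 4 : ℂ) =
      ((√‖(1 + A).det‖ * (matX A).det ^ (1 / 4 : ℝ) : ℝ) : ℂ) := by
    rw [det_one_sub hA, show (1 / 4 : ℂ) = ((1 / 4 : ℝ) : ℂ) by push_cast; rfl,
      ← Complex.ofReal_cpow (by positivity), Real.mul_rpow (by positivity) hX.le,
      ← Real.rpow_natCast, ← Real.rpow_mul hq.le, Real.sqrt_eq_rpow]
    norm_num
  have h2 : ((matX A).det / Real.pi ^ n) ^ (1 / 4 : ℝ) =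
      Real.pi ^ (-(n : ℝ) / 4) * (matX A).det ^ (1 / 4 : ℝ) := by
    rw [Real.div_rpow hX.le (by positivity), ← Real.rpow_natCast, ← Real.rpow_mul (by positivity),
      div_eq_mul_inv, ← Real.rpow_neg (by positivity), mul_comm]
    congr 2
    ring
  rw [phase_eq hA, h1, h2]
  push_cast
  ring

end Schrodinger

/-! ### The inverse Bargmann transform -/

theorem detSqrt_one : detSqrt (1 : Matrix (Fin n) (Fin n) ℂ) = 1 := by
  have h := integral_gaussFun_zero isAccretive_one (isSymm_one (n := Fin n) (α := ℂ))
  rw [integral_gaussFun_one] at h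
  have h3 : ((√(2 * Real.pi) ^ n : ℝ) : ℂ) ≠ 0 := by
    have : 0 < √(2 * Real.pi) := by positivity
    exact_mod_cast (pow_pos this n).ne'
  exact mul_left_cancel₀ h3 (h.trans (mul_one _).symm)

theorem integral_gaussFun_one_mulVec (b : Fin n → ℂ) :
    ∫ x, gaussFun 1 b x = ((√(2 * Real.pi) ^ n : ℝ) : ℂ) * Complex.exp (1 / 2 * (b ⬝ᵥ b)) := by
  have h := (gaussian_integral isAccretive_one (isSymm_one (n := Fin n) (α := ℂ)) b).2
  rwa [one_mulVec, detSqrt_one, div_one] at h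

theorem norm_exp_star_mul_expQuad_le (A : Matrix (Fin n) (Fin n) ℂ) (s z : Fin n → ℂ) :
    ‖Complex.exp (star z ⬝ᵥ s) * expQuad A z‖ ≤
      Real.exp (‖Matrix.toEuclideanCLM (n := Fin n) (𝕜 := ℂ) A‖ / 2 * nsq z +
        √(nsq s) * √(nsq z)) := by
  rw [norm_mul, add_comm, Real.exp_add]
  refine mul_le_mul ?_ (norm_expQuad_le A z) (norm_nonneg _) (Real.exp_pos _).le
  refine (Complex.norm_exp_le_exp_norm _).trans (Real.exp_le_exp.2 ?_)
  refine (norm_dotProduct_le _ _).trans ?_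
  rw [nsq_star, mul_comm]

theorem continuous_exp_star_mul_expQuad (A : Matrix (Fin n) (Fin n) ℂ) (s : Fin n → ℂ) :
    Continuous fun z => Complex.exp (star z ⬝ᵥ s) * expQuad A z := by
  have := (differentiable_expQuad A).continuous
  have h : Continuous fun z : Fin n → ℂ => star z ⬝ᵥ s := by
    simp only [dotProduct, Pi.star_apply]
    fun_prop
  fun_prop

theorem integral_exp_star_mul_expQuad (hA : A ∈ domainD n) (s : Fin n → ℂ) :
    ∫ z, Complex.exp (star z ⬝ᵥ s) * expQuad A z ∂(gaussMeasure n) = expQuad A s := by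
  refine integral_exp_star_dotProduct_mul (differentiable_expQuad A) s ?_
  refine integrable_gaussMeasure_of_le (continuous_exp_star_mul_expQuad A s) (C := 1)
    (k := ‖Matrix.toEuclideanCLM (n := Fin n) (𝕜 := ℂ) A‖ / 2) (m := √(nsq s)) ?_ fun z => ?_
  · have := hA.2
    have := norm_nonneg (Matrix.toEuclideanCLM (n := Fin n) (𝕜 := ℂ) A)
    linarith
  · rw [one_mul]; exact norm_exp_star_mul_expQuad_le A s z

theorem invBargmannKernel_eq (x : Fin n → ℝ) (z : Fin n → ℂ) :
    invBargmannKernel x z = Complex.exp (-(star z ⬝ᵥ star z) / 2) *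
      Complex.exp (star z ⬝ᵥ ((√2 : ℝ) : ℂ) • cvec x) := by
  rw [invBargmannKernel, Complex.exp_add, dotProduct_smul]
  rfl

theorem continuous_star_dotProduct_star : Continuous fun z : Fin n → ℂ => star z ⬝ᵥ star z := by
  simp only [dotProduct, Pi.star_apply]
  fun_prop

theorem integrable_invBargmannKernel_mul_expQuad (hA : A ∈ domainD n) (x : Fin n → ℝ) :
    Integrable (fun z => invBargmannKernel x z * expQuad A z) (gaussMeasure n) := by
  have hc := continuous_star_dotProduct_star (n := n)
  simp only [invBargmannKernel_eq, mul_assoc]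
  refine integrable_gaussMeasure_of_le (C := 1)
    (k := 1 / 2 + ‖Matrix.toEuclideanCLM (n := Fin n) (𝕜 := ℂ) A‖ / 2)
    (m := √(nsq (((√2 : ℝ) : ℂ) • cvec x)))
    (Continuous.mul (by fun_prop) (continuous_exp_star_mul_expQuad A _))
    (by have := hA.2; linarith) fun z => ?_
  rw [one_mul, norm_mul, add_mul, add_assoc, Real.exp_add]
  refine mul_le_mul ?_ (norm_exp_star_mul_expQuad_le A _ z) (norm_nonneg _) (Real.exp_pos _).le
  refine (Complex.norm_exp_le_exp_norm _).trans (Real.exp_le_exp.2 ?_)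
  have := norm_dotProduct_le (star z) (star z)
  rw [nsq_star, Real.mul_self_sqrt (nsq_nonneg z)] at this
  rw [norm_div, norm_neg, Complex.norm_ofNat]
  linarith

theorem integrable_exp_neg_nsq_cvec {δ : ℝ} (hδ : 0 < δ) :
    Integrable fun t : Fin n → ℝ => Real.exp (-δ * nsq (cvec t)) := by
  refine (GaussianFourier.integrable_cexp_neg_mul_sum_add (ι := Fin n) (b := (δ : ℂ))
      (by simpa using hδ) 0).norm.congr (Filter.Eventually.of_forall fun t => ?_)
  simp only [Complex.norm_exp]
  congr 1
  simp [nsq, cvec, ← Complex.ofReal_pow, ← Complex.ofReal_sum]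

theorem gaussFun_one_eq (b : Fin n → ℂ) (t : Fin n → ℝ) :
    gaussFun 1 b t = Complex.exp (-(1 / 2) * (cvec t ⬝ᵥ cvec t)) * Complex.exp (b ⬝ᵥ cvec t) := by
  rw [gaussFun, one_mulVec, Complex.exp_add]

theorem norm_gaussFun_one_le (b : Fin n → ℂ) (t : Fin n → ℝ) :
    ‖gaussFun 1 b t‖ ≤ Real.exp (-(1 / 2) * nsq (cvec t) + √(nsq b) * √(nsq (cvec t))) := by
  have h : cvec t ⬝ᵥ cvec t = (nsq (cvec t) : ℂ) := by
    rw [← star_dotProduct_self, star_cvec]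
  rw [gaussFun_one_eq, norm_mul, Real.exp_add, h]
  refine mul_le_mul ?_ ((Complex.norm_exp_le_exp_norm _).trans
    (Real.exp_le_exp.2 (norm_dotProduct_le _ _))) (norm_nonneg _) (Real.exp_pos _).le
  rw [Complex.norm_exp]
  refine le_of_eq (congrArg _ ?_)
  rw [Complex.re_mul_ofReal]
  norm_num

/-- Absolute convergence of the double integral that computes the inverse Bargmann transform. -/
theorem integrable_gaussFun_prod (hA : A ∈ domainD n) (s : Fin n → ℂ) :
    Integrable (Function.uncurry fun (t : Fin n → ℝ) (z : Fin n → ℂ) =>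
      gaussFun 1 (Complex.I • star z) t * (Complex.exp (star z ⬝ᵥ s) * expQuad A z))
      ((volume : Measure (Fin n → ℝ)).prod (gaussMeasure n)) := by
  set a := ‖Matrix.toEuclideanCLM (n := Fin n) (𝕜 := ℂ) A‖ with ha
  have ha1 : a < 1 := hA.2
  have ha0 : 0 ≤ a := norm_nonneg _
  have h3 : 0 < 3 - a := by linarith
  -- With `σ = |z|`, `τ = |t|`, the cross term obeys `στ ≤ cσ² + τ²/(4c)`. Integrability needs `a/2
  -- + c < 1` and `1/(4c) < 1/2`; the midpoint `c = (3 - a)/4` of the admissible interval gives the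
  -- constants here and in `h2`.
  have h1 : Integrable (fun t : Fin n → ℝ => Real.exp (-((1 - a) / (2 * (3 - a))) *
      nsq (cvec t))) := integrable_exp_neg_nsq_cvec (div_pos (by linarith) (by linarith))
  have h2 : Integrable (fun z : Fin n → ℂ => Real.exp ((a + 3) / 4 * nsq z +
      √(nsq s) * √(nsq z))) (gaussMeasure n) := by
    have hc : Continuous fun z : Fin n → ℂ => ((Real.exp ((a + 3) / 4 * nsq z +
        √(nsq s) * √(nsq z)) : ℝ) : ℂ) := by
      have := continuous_nsq (n := n)
      fun_prop
    have := (integrable_gaussMeasure_of_le hc (C := 1) (k := (a + 3) / 4) (m := √(nsq s))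
      (by linarith) (fun z => by rw [Complex.norm_real, Real.norm_of_nonneg (Real.exp_pos _).le,
        one_mul])).re
    exact this
  refine (h1.mul_prod h2).mono' ?_ (Filter.Eventually.of_forall fun p => ?_)
  · refine Continuous.aestronglyMeasurable ?_
    have hc1 := continuous_cvec (n := n)
    have hc2 := (differentiable_expQuad A).continuous
    have hc3 : Continuous fun p : (Fin n → ℝ) × (Fin n → ℂ) => star p.2 ⬝ᵥ s := by
      simp only [dotProduct, Pi.star_apply]
      fun_prop
    have hc4 : Continuous fun p : (Fin n → ℝ) × (Fin n → ℂ) =>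
        (Complex.I • star p.2) ⬝ᵥ cvec p.1 := by
      simp only [dotProduct, Pi.star_apply, Pi.smul_apply, cvec]
      fun_prop
    simp only [Function.uncurry_def, gaussFun_one_eq]
    fun_prop
  · obtain ⟨t, z⟩ := p
    simp only [Function.uncurry_apply_pair]
    rw [norm_mul]
    refine (mul_le_mul (norm_gaussFun_one_le _ t) (norm_exp_star_mul_expQuad_le A s z)
      (norm_nonneg _) (Real.exp_pos _).le).trans ?_
    rw [← Real.exp_add, ← Real.exp_add]
    refine Real.exp_le_exp.2 ?_
    have hI : nsq (Complex.I • star z) = nsq z := by simp [nsq]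
    rw [hI, ← ha]
    have e1 := Real.sq_sqrt (nsq_nonneg z)
    have e2 := Real.sq_sqrt (nsq_nonneg (cvec t))
    set σ := √(nsq z)
    set τ := √(nsq (cvec t))
    rw [← e1, ← e2]
    have key : σ * τ ≤ (3 - a) / 4 * σ ^ 2 + 1 / (3 - a) * τ ^ 2 := by
      rw [← sub_nonneg]
      have : (3 - a) / 4 * σ ^ 2 + 1 / (3 - a) * τ ^ 2 - σ * τ =
          ((3 - a) * σ - 2 * τ) ^ 2 / (4 * (3 - a)) := by field_simp; ring
      rw [this]; positivity
    have e3 : (1 - a) / (2 * (3 - a)) = 1 / 2 - 1 / (3 - a) := by field_simp; ring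
    rw [e3]
    linarith

/-- The factor `i² = -1` turns the `t`-part of the quadratic form into `-½ t·At`, which joins `-½
t·t` to make the matrix `I + A`. -/
theorem expQuad_add_I_smul (hA : A.IsSymm) (x t : Fin n → ℝ) :
    Complex.exp (-(1 / 2) * (cvec t ⬝ᵥ cvec t)) *
        expQuad A (((√2 : ℝ) : ℂ) • cvec x + Complex.I • cvec t) =
      Complex.exp (cvec x ⬝ᵥ A *ᵥ cvec x) *
        gaussFun (1 + A) ((Complex.I * ((√2 : ℝ) : ℂ)) • A *ᵥ cvec x) t := by
  have hsymm : ∀ u v : Fin n → ℂ, u ⬝ᵥ A *ᵥ v = (A *ᵥ u) ⬝ᵥ v := fun u v => by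
    rw [dotProduct_mulVec, ← mulVec_transpose, hA.eq]
  have h2 : ((√2 : ℝ) : ℂ) ^ 2 = 2 := by
    rw [← Complex.ofReal_pow, Real.sq_sqrt (by norm_num)]; norm_num
  rw [expQuad, gaussFun, ← Complex.exp_add, ← Complex.exp_add]
  congr 1
  simp only [mulVec_add, mulVec_smul, add_mulVec, one_mulVec, add_dotProduct, dotProduct_add,
    smul_dotProduct, dotProduct_smul, smul_eq_mul]
  rw [dotProduct_comm (cvec t) (A *ᵥ cvec x), hsymm (cvec x) (cvec t)]
  linear_combination (cvec x ⬝ᵥ A *ᵥ cvec x) / 2 * h2 +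
    (cvec t ⬝ᵥ A *ᵥ cvec t) / 2 * Complex.I_sq

theorem integral_invBargmannKernel_mul_expQuad (hA : A ∈ domainD n) (x : Fin n → ℝ) :
    ∫ z, invBargmannKernel x z * expQuad A z ∂(gaussMeasure n) =
      1 / detSqrt (1 + A) * Complex.exp (cvec x ⬝ᵥ A *ᵥ cvec x -
        (A *ᵥ cvec x) ⬝ᵥ ((1 + A)⁻¹ *ᵥ (A *ᵥ cvec x))) := by
  have hu := (isUnit_iff_isUnit_det _).1 (isUnit_one_add hA)
  have hc : ((√(2 * Real.pi) ^ n : ℝ) : ℂ) ≠ 0 := by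
    have : 0 < √(2 * Real.pi) := by positivity
    exact_mod_cast (pow_pos this n).ne'
  have hsw := integral_integral_swap (integrable_gaussFun_prod hA (((√2 : ℝ) : ℂ) • cvec x))
  have hr : ∀ z : Fin n → ℂ, ∫ t, gaussFun 1 (Complex.I • star z) t *
      (Complex.exp (star z ⬝ᵥ ((√2 : ℝ) : ℂ) • cvec x) * expQuad A z) =
      ((√(2 * Real.pi) ^ n : ℝ) : ℂ) * (invBargmannKernel x z * expQuad A z) := fun z => by
    rw [integral_mul_const, integral_gaussFun_one_mulVec, invBargmannKernel_eq]
    have : 1 / 2 * ((Complex.I • star z) ⬝ᵥ (Complex.I • star z)) = -(star z ⬝ᵥ star z) / 2 := by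
      rw [smul_dotProduct, dotProduct_smul, smul_smul, Complex.I_mul_I, smul_eq_mul]
      ring
    rw [this]
    ring
  have hl : ∀ t : Fin n → ℝ, ∫ z, gaussFun 1 (Complex.I • star z) t *
      (Complex.exp (star z ⬝ᵥ ((√2 : ℝ) : ℂ) • cvec x) * expQuad A z) ∂(gaussMeasure n) =
      Complex.exp (cvec x ⬝ᵥ A *ᵥ cvec x) *
        gaussFun (1 + A) ((Complex.I * ((√2 : ℝ) : ℂ)) • A *ᵥ cvec x) t := fun t => by
    rw [← expQuad_add_I_smul hA.1, ← integral_exp_star_mul_expQuad hA, ← integral_const_mul]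
    congr 1
    ext z
    have hI : (Complex.I • star z) ⬝ᵥ cvec t = star z ⬝ᵥ Complex.I • cvec t := by
      rw [smul_dotProduct, dotProduct_smul]
    rw [gaussFun_one_eq, dotProduct_add, Complex.exp_add, hI]
    ring
  simp only [hl, hr] at hsw
  rw [integral_const_mul, integral_const_mul] at hsw
  refine mul_left_cancel₀ hc (hsw.symm.trans ?_)
  have hg := (gaussian_integral (isAccretive_one_add hA) (one_add_isSymm hA)
    ((1 + A)⁻¹ *ᵥ ((Complex.I * ((√2 : ℝ) : ℂ)) • A *ᵥ cvec x))).2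
  rw [mulVec_mulVec, mul_nonsing_inv _ hu, one_mulVec] at hg
  rw [hg, sub_eq_add_neg, Complex.exp_add]
  have h2 : ((√2 : ℝ) : ℂ) ^ 2 = 2 := by
    rw [← Complex.ofReal_pow, Real.sq_sqrt (by norm_num)]; norm_num
  have : 1 / 2 * (((1 + A)⁻¹ *ᵥ ((Complex.I * ((√2 : ℝ) : ℂ)) • A *ᵥ cvec x)) ⬝ᵥ
      ((Complex.I * ((√2 : ℝ) : ℂ)) • A *ᵥ cvec x)) =
      -((A *ᵥ cvec x) ⬝ᵥ ((1 + A)⁻¹ *ᵥ (A *ᵥ cvec x))) := by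
    rw [mulVec_smul, smul_dotProduct, dotProduct_smul, smul_eq_mul, smul_eq_mul,
      dotProduct_comm (A *ᵥ cvec x)]
    linear_combination (((1 + A)⁻¹ *ᵥ A *ᵥ cvec x) ⬝ᵥ (A *ᵥ cvec x)) / 2 *
      (((√2 : ℝ) : ℂ) ^ 2 * Complex.I_sq - h2)
  rw [this]
  ring

/-- With `R = (I + A)⁻¹`, one has `A R A = A - I + R` and `Z = 2R - I`, so `-I/2 + A - A R A = I/2 -
R = -Z/2`. -/
theorem schrodinger_exponent (hA : A ∈ domainD n) (v : Fin n → ℂ) :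
    -(v ⬝ᵥ v) / 2 + (v ⬝ᵥ A *ᵥ v - (A *ᵥ v) ⬝ᵥ ((1 + A)⁻¹ *ᵥ (A *ᵥ v))) =
      -(v ⬝ᵥ matZ A *ᵥ v) / 2 := by
  have hu := (isUnit_iff_isUnit_det _).1 (isUnit_one_add hA)
  have hZ : matZ A = (2 : ℂ) • (1 + A)⁻¹ - 1 := by rw [← one_add_matZ hA]; abel
  have h1 : A * (1 + A)⁻¹ = 1 - (1 + A)⁻¹ := by
    have := mul_nonsing_inv _ hu
    rw [add_mul, one_mul] at this
    exact eq_sub_of_add_eq' this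
  have h2 : (1 + A)⁻¹ * A = 1 - (1 + A)⁻¹ := by
    have := nonsing_inv_mul _ hu
    rw [mul_add, mul_one] at this
    exact eq_sub_of_add_eq' this
  have h3 : A * ((1 + A)⁻¹ * A) = A - 1 + (1 + A)⁻¹ := by
    rw [← mul_assoc, h1, sub_mul, one_mul, h2]; abel
  have h4 : (A *ᵥ v) ⬝ᵥ ((1 + A)⁻¹ *ᵥ (A *ᵥ v)) = v ⬝ᵥ (A - 1 + (1 + A)⁻¹) *ᵥ v := by
    rw [← h3, ← mulVec_mulVec, ← mulVec_mulVec, dotProduct_mulVec v, ← mulVec_transpose, hA.1.eq]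
  rw [h4, hZ]
  simp only [add_mulVec, sub_mulVec, smul_mulVec, one_mulVec, dotProduct_add, dotProduct_sub,
    dotProduct_smul, smul_eq_mul]
  ring

theorem squeezedSchrodinger_eq (hA : A ∈ domainD n) (x : Fin n → ℝ) :
    squeezedSchrodinger A x =
      ((Real.pi ^ (-(n : ℝ) / 4) : ℝ) : ℂ) *
        ((1 - Aᴴ * A).det ^ (1 / 4 : ℂ) / detSqrt (1 + A)) *
        Complex.exp (-(cvec x ⬝ᵥ matZ A *ᵥ cvec x) / 2) := by
  have h : ∀ z, invBargmannKernel x z * squeezedState A z =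
      (1 - Aᴴ * A).det ^ (1 / 4 : ℂ) * (invBargmannKernel x z * expQuad A z) := fun z => by
    rw [squeezedState_eq hA]; ring
  simp only [squeezedSchrodinger, invBargmann, h]
  rw [integral_const_mul, integral_invBargmannKernel_mul_expQuad hA, ← schrodinger_exponent hA,
    Complex.exp_add, cvec_dotProduct]
  ring

theorem integrable_invBargmannKernel_mul_squeezedState (hA : A ∈ domainD n) (x : Fin n → ℝ) :
    Integrable (fun z => invBargmannKernel x z * squeezedState A z) (gaussMeasure n) := by
  have h : ∀ z, invBargmannKernel x z * squeezedState A z =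
      (1 - Aᴴ * A).det ^ (1 / 4 : ℂ) * (invBargmannKernel x z * expQuad A z) := fun z => by
    rw [squeezedState_eq hA]; ring
  simp only [h]
  exact (integrable_invBargmannKernel_mul_expQuad hA x).const_mul _

/-! ### The norm of the Schrödinger form -/

theorem norm_sq_squeezedSchrodinger (hA : A ∈ domainD n) (x : Fin n → ℝ) :
    ((‖squeezedSchrodinger A x‖ ^ 2 : ℝ) : ℂ) =
      ((√((matX A).det / Real.pi ^ n) : ℝ) : ℂ) *
        gaussFun ((2 : ℂ) • (matX A).map Complex.ofReal) 0 x := by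
  have hX := (matX_posDef hA).det_pos
  rw [squeezedSchrodinger_eq hA, ← phase_mul hA, norm_mul, norm_mul, norm_phase hA, one_mul,
    Complex.norm_real, Real.norm_of_nonneg (by positivity), mul_pow]
  have h1 : (((matX A).det / Real.pi ^ n) ^ (1 / 4 : ℝ)) ^ 2 = √((matX A).det / Real.pi ^ n) := by
    rw [← Real.rpow_natCast, ← Real.rpow_mul (by positivity), Real.sqrt_eq_rpow]
    norm_num
  rw [h1, Complex.norm_exp, ← Real.exp_nat_mul, gaussFun, zero_dotProduct, smul_mulVec,
    cvec_mulVec, dotProduct_smul, cvec_dotProduct]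
  have h2 : (-(cvec x ⬝ᵥ matZ A *ᵥ cvec x) / 2).re = -(x ⬝ᵥ matX A *ᵥ x) / 2 := by
    rw [Complex.div_ofNat_re, Complex.neg_re, re_quad_cvec]; rfl
  rw [h2]
  push_cast
  congr 2
  simp only [smul_eq_mul]
  ring

theorem continuous_squeezedSchrodinger (hA : A ∈ domainD n) :
    Continuous (squeezedSchrodinger A) := by
  have := continuous_cvec (n := n)
  rw [funext (squeezedSchrodinger_eq hA)]
  fun_prop

theorem integrable_and_integral_norm_sq (hA : A ∈ domainD n) :
    Integrable (fun x => ‖squeezedSchrodinger A x‖ ^ 2) ∧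
      ∫ x, ‖squeezedSchrodinger A x‖ ^ 2 = 1 := by
  have hX := (matX_posDef hA).det_pos
  have hsymm : ((2 : ℂ) • (matX A).map Complex.ofReal).IsSymm := by
    have := (matX_posDef hA).1
    rw [Matrix.IsHermitian, conjTranspose_eq_transpose_of_trivial] at this
    rw [IsSymm, transpose_smul, ← transpose_map, this]
  -- Knowing `g²` suffices: the integral of `|ψ|²` is nonnegative, so it is `1` once its square is.
  obtain ⟨g, hg, h⟩ := exists_gaussian_integral (isAccretive_two_smul_matX hA) hsymm
  have h0 := h 0
  rw [mulVec_zero, zero_dotProduct, mul_zero, Complex.exp_zero, mul_one] at h0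
  have hint : Integrable (fun x => ((‖squeezedSchrodinger A x‖ ^ 2 : ℝ) : ℂ)) := by
    simp only [norm_sq_squeezedSchrodinger hA]
    exact h0.1.const_mul _
  refine ⟨hint.re, ?_⟩
  have hval : ((∫ x, ‖squeezedSchrodinger A x‖ ^ 2 : ℝ) : ℂ) =
      ((√((matX A).det / Real.pi ^ n) : ℝ) : ℂ) * g := by
    rw [← integral_complex_ofReal]
    simp only [norm_sq_squeezedSchrodinger hA]
    rw [integral_const_mul, h0.2]
  have hnn : 0 ≤ ∫ x, ‖squeezedSchrodinger A x‖ ^ 2 := integral_nonneg fun x => by positivity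
  have hdet : ((matX A).map Complex.ofReal).det = ((matX A).det : ℂ) :=
    (Complex.ofRealHom.map_det (matX A)).symm
  rw [det_smul, hdet, Fintype.card_fin, mul_pow] at hg
  have hsq : ((∫ x, ‖squeezedSchrodinger A x‖ ^ 2 : ℝ) : ℂ) ^ 2 = 1 := by
    rw [hval, mul_pow, ← Complex.ofReal_pow, Real.sq_sqrt (by positivity)]
    have h2 : (2 : ℂ) ^ n ≠ 0 := by positivity
    have hpi : (Real.pi : ℂ) ^ n ≠ 0 := pow_ne_zero _ (by exact_mod_cast Real.pi_ne_zero)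
    have hg' : g ^ 2 * ((matX A).det : ℂ) = Real.pi ^ n :=
      mul_left_cancel₀ h2 (by linear_combination hg)
    push_cast
    field_simp
    linear_combination hg'
  have hsq' : (∫ x, ‖squeezedSchrodinger A x‖ ^ 2) ^ 2 = 1 := by exact_mod_cast hsq
  exact (pow_eq_one_iff_of_nonneg hnn two_ne_zero).1 hsq'

/-! ### The Bargmann transform of the Schrödinger form -/

theorem bargmannKernel_mul (hA : A ∈ domainD n) (z : Fin n → ℂ) (x : Fin n → ℝ) :
    bargmannKernel z x * squeezedSchrodinger A x =
      ((Real.pi ^ (-(n : ℝ) / 4) : ℝ) : ℂ) *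
        ((1 - Aᴴ * A).det ^ (1 / 4 : ℂ) / detSqrt (1 + A)) *
        gaussFun (1 + matZ A) (((√2 : ℝ) : ℂ) • z) x := by
  rw [squeezedSchrodinger_eq hA, mul_left_comm, bargmannKernel, gaussFun, ← Complex.exp_add,
    ← cvec_dotProduct, add_mulVec, one_mulVec, dotProduct_add, smul_dotProduct, smul_eq_mul]
  congr 2
  change _ + ((√2 : ℝ) : ℂ) * (z ⬝ᵥ cvec x) + _ = _
  ring

theorem bargmann_squeezedSchrodinger (hA : A ∈ domainD n) (z : Fin n → ℂ) :
    Integrable (fun x => bargmannKernel z x * squeezedSchrodinger A x) ∧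
      bargmann (squeezedSchrodinger A) z = squeezedState A z := by
  have hu := (isUnit_iff_isUnit_det _).1 (isUnit_one_add hA)
  have h2 : ((√2 : ℝ) : ℂ) ^ 2 = 2 := by
    rw [← Complex.ofReal_pow, Real.sq_sqrt (by norm_num)]; norm_num
  -- The vector is `(I + Z)⁻¹ √2 z`, since `(I + Z)⁻¹ = (I + A)/2`.
  have hg := gaussian_integral (isAccretive_one_add_matZ hA) (one_add_matZ_isSymm hA)
    ((((√2 : ℝ) : ℂ) / 2) • (1 + A) *ᵥ z)
  have hb : (1 + matZ A) *ᵥ ((((√2 : ℝ) : ℂ) / 2) • (1 + A) *ᵥ z) = ((√2 : ℝ) : ℂ) • z := by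
    rw [mulVec_smul, mulVec_mulVec, one_add_matZ hA, smul_mul_assoc, nonsing_inv_mul _ hu,
      smul_mulVec, one_mulVec, smul_smul]
    congr 1
    ring
  rw [hb] at hg
  simp only [bargmannKernel_mul hA, bargmann]
  refine ⟨hg.1.const_mul _, ?_⟩
  rw [integral_const_mul, hg.2, squeezedState_eq hA, expQuad]
  have hexp : 1 / 2 * (((((√2 : ℝ) : ℂ) / 2) • (1 + A) *ᵥ z) ⬝ᵥ ((√2 : ℝ) : ℂ) • z) =
      (z ⬝ᵥ z) / 2 + (z ⬝ᵥ A *ᵥ z) / 2 := by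
    rw [smul_dotProduct, dotProduct_smul, add_mulVec, one_mulVec, add_dotProduct,
      dotProduct_comm (A *ᵥ z), smul_eq_mul, smul_eq_mul]
    linear_combination (z ⬝ᵥ z + z ⬝ᵥ A *ᵥ z) / 4 * h2
  have hs := detSqrt_ne_zero (isAccretive_one_add hA)
  have hs' := detSqrt_ne_zero (isAccretive_one_add_matZ hA)
  have h1 := detSqrt_two_smul_inv (isAccretive_one_add hA)
  rw [← one_add_matZ hA] at h1
  -- The two normalizations and the Gaussian constant multiply to `2^{n/2}`, which is the product of
  -- the square roots for `I + Z` and `I + A`.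
  have hpi : ((Real.pi ^ (-(n : ℝ) / 4) : ℝ) : ℂ) * ((Real.pi ^ (-(n : ℝ) / 4) : ℝ) : ℂ) *
      ((√(2 * Real.pi) ^ n : ℝ) : ℂ) = ((√2 ^ n : ℝ) : ℂ) := by
    rw [← Complex.ofReal_mul, ← Complex.ofReal_mul]
    congr 1
    rw [Real.sqrt_mul (by norm_num), mul_pow, Real.sqrt_eq_rpow Real.pi,
      ← Real.rpow_natCast (Real.pi ^ (1 / 2 : ℝ)), ← Real.rpow_mul (by positivity),
      ← Real.rpow_add Real.pi_pos, mul_left_comm, ← Real.rpow_add Real.pi_pos]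
    ring_nf
    simp
  rw [hexp, Complex.exp_add, show -(z ⬝ᵥ z) / 2 = -((z ⬝ᵥ z) / 2) by ring, Complex.exp_neg]
  have he := Complex.exp_ne_zero ((z ⬝ᵥ z) / 2)
  rw [← h1] at hpi
  generalize ((Real.pi ^ (-(n : ℝ) / 4) : ℝ) : ℂ) = p at hpi ⊢
  field_simp
  linear_combination ((1 - Aᴴ * A).det ^ (1 / 4 : ℂ)) * hpi

end Squeezed

end

theorem mainTheorem8 (n : ℕ) (A : Matrix (Fin n) (Fin n) ℂ) (hA : A ∈ Squeezed.domainD n) :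
    -- `ι(A)` lies in `Sp_c`, and the integral defining `e_A = U_{ι(A)} 1` converges
    Squeezed.iota A ∈ Squeezed.SpC n ∧
    (∀ z : Fin n → ℂ,
      Integrable (fun w => Squeezed.metaplecticKernel (Squeezed.iota A) z w)
        (Squeezed.gaussMeasure n)) ∧
    -- the Bargmann form
    Squeezed.squeezedState A ∈ Squeezed.fock n ∧
    (∀ z : Fin n → ℂ,
      Squeezed.squeezedState A z =
        (1 - Aᴴ * A).det ^ (1 / 4 : ℂ) * Complex.exp ((z ⬝ᵥ (A *ᵥ z)) / 2)) ∧
    -- the matrix `Z = (I - A)(I + A)⁻¹ = X + iY`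
    IsUnit (1 + A) ∧
    (Squeezed.matX A).IsSymm ∧ (Squeezed.matY A).IsSymm ∧ (Squeezed.matX A).PosDef ∧
    ‖Squeezed.phase A‖ = 1 ∧
    -- the Schrödinger form
    (∀ x : Fin n → ℝ,
      Integrable (fun z => Squeezed.invBargmannKernel x z * Squeezed.squeezedState A z)
        (Squeezed.gaussMeasure n)) ∧
    (∀ x : Fin n → ℝ,
      Squeezed.squeezedSchrodinger A x =
        Squeezed.phase A *
          ((((Squeezed.matX A).det / Real.pi ^ n) ^ (1 / 4 : ℝ) : ℝ) : ℂ) *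
          Complex.exp
            (-((fun i => (x i : ℂ)) ⬝ᵥ (Squeezed.matZ A *ᵥ fun i => (x i : ℂ))) / 2)) ∧
    -- it is a unit vector of `L²(ℝⁿ)` whose Bargmann transform is `e_A`
    MemLp (Squeezed.squeezedSchrodinger A) 2 volume ∧
    (∫ x, ‖Squeezed.squeezedSchrodinger A x‖ ^ 2) = 1 ∧
    (∀ z : Fin n → ℂ,
      Integrable (fun x => Squeezed.bargmannKernel z x * Squeezed.squeezedSchrodinger A x) ∧
      Squeezed.bargmann (Squeezed.squeezedSchrodinger A) z = Squeezed.squeezedState A z) := by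
  have he := Squeezed.squeezedState_eq hA
  have hn := Squeezed.integrable_and_integral_norm_sq hA
  refine ⟨Squeezed.iota_mem_SpC hA, Squeezed.integrable_metaplecticKernel_iota hA,
    Squeezed.squeezedState_mem_fock hA, he, Squeezed.isUnit_one_add hA, ?_, ?_,
    Squeezed.matX_posDef hA, Squeezed.norm_phase hA,
    Squeezed.integrable_invBargmannKernel_mul_squeezedState hA, fun x => ?_, ?_, hn.2,
    Squeezed.bargmann_squeezedSchrodinger hA⟩
  · rw [Matrix.IsSymm, Squeezed.matX, ← transpose_map, (Squeezed.matZ_isSymm hA).eq]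
  · rw [Matrix.IsSymm, Squeezed.matY, ← transpose_map, (Squeezed.matZ_isSymm hA).eq]
  · rw [Squeezed.phase_mul hA]
    exact Squeezed.squeezedSchrodinger_eq hA x
  · exact (memLp_two_iff_integrable_sq_norm
      (Squeezed.continuous_squeezedSchrodinger hA).aestronglyMeasurable).2 hn.1
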